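/- All graphs below are simple and may be infinite. A \emph{separation} of a graph $G$ is an ordered pair $(A,B)$ of vertex sets with $A\cup B=V(G)$ and no edge between $A\setminus B$ and $B\setminus A$; its \emph{order} is $|A\cap B|$, and $(A,B)\le(C,D)$ means $A\subseteq C$ and $D\subseteq B$. A set $P$ of separations of $G$ is a \emph{profile} if (P1) whenever $(C,D)\le(A,B)$ are separations with $(A,B)\in P$, then $(D,C)\notin P$; and (P2) whenever $(A,B),(C,D)\in P$, then $(B\cap D,A\cup C)\notin P$. For $\ell\in\mathbb N\cup\{\infty\}$ it is an \emph{$\ell$-profile} if all its elements have order $<\ell$ and for every separation $(A,B)$ of order $<\ell$ one of $(A,B)$, $(B,A)$ lies in $P$. It is \emph{robust} if for every $(A,B)\in P$ and every separation $(C,D)$ of finite order such that $(B\cap C,A\cup D)$ and $(B\cap D,A\cup C)$ both have order less than $|A\cap B|$, at least one of these two separations is not in $P$. A separation $(A,B)$ \emph{distinguishes} $P$ and $P'$ if $(A,B)\in P$ and $(B,A)\in P'$ or vice versa, and it does so \emph{efficiently} if no separation of smaller order distinguishes them; $P$ and $P'$ are \emph{$k$-distinguishable} if some separation of order at most $k$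 distinguishes them. A \emph{tree-decomposition} of $G$ is a pair $(T,(V_t)_{t\in V(T)})$ of a tree $T$ and vertex sets $V_t\subseteq V(G)$ such that $\bigcup_t V_t=V(G)$, every edge of $G$ has both ends in some $V_t$, and $V_{t_1}\cap V_{t_3}\subseteq V_{t_2}$ whenever $t_2$ lies on the $t_1$--$t_3$ path in $T$. An edge $e$ of $T$ \emph{induces} the separation $(\bigcup_{t\in T_1}V_t,\bigcup_{t\in T_2}V_t)$, where $T_1,T_2$ are the two components of $T-e$. A tree-decomposition \emph{distinguishes} $P$ and $P'$ \emph{efficiently} if some separation induced by an edge of $T$ does so. A construction $\psi$ that assigns to each pair $(G,\mathcal P)$ of some class a tree-decomposition of $G$ is \emph{canonical} if it commutes with isomorphisms: every isomorphism $\varphi\colon G\to G'$ with $\varphi(\mathcal P)=\mathcal P'$ induces an isomorphism between the decomposition trees of $\psi(G,\mathcal P)$ and $\psi(G',\mathcal P')$ that sends each node with part $V_t$ to a node with part $\varphi(V_t)$, functorially in $\varphi$ (that is, respecting identities and composition). Canonical constructions on a class of graphs (without $\mathcal P$) are defined in the same way, with respect to all graph isomorphisms. \textbf{Theorem.} Let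 $k\in\mathbb N$. (1) There is a canonical construction that assigns to every pair $(G,\mathcal P)$, where $G$ is a connected locally finite graph and $\mathcal P$ is a set of pairwise $k$-distinguishable robust profiles of $G$ each of which is an $\ell$-profile for some $\ell\in\mathbb N\cup\{\infty\}$, a tree-decomposition of $G$ that distinguishes every two distinct profiles in $\mathcal P$ efficiently. (2) There is a canonical construction that assigns to every connected locally finite graph $G$ a tree-decomposition of $G$ that distinguishes efficiently every two ends of $G$ that are distinguishable by at most $k$ vertices. Here an end is an equivalence class of rays (one-way infinite paths), two rays being equivalent if for every finite $S\subseteq V(G)$ some component of $G-S$ contains all but finitely many vertices of each; two ends are distinguishable by at most $k$ vertices if they lie in distinct components of $G-S$ for some $S$ with $|S|\le k$; and a tree-decomposition distinguishes two ends $\omega,\omega'$ efficiently if it distinguishes $P_\omega,P_{\omega'}$ efficiently, where $P_\omega$ is the set of separations $(A,B)$ of finite order such that the component of $G-(A\cap B)$ in which $\omega$ lies is included in $B$. -/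

import Mathlib

universe u

namespace CanonicalTD

variable {V : Type u}

/-! ### Separations -/

/-- `(A, B)` is a separation of `G`: `G[A] ∪ G[B] = G`. -/
def IsSeparation (G : SimpleGraph V) (s : Set V × Set V) : Prop :=
  s.1 ∪ s.2 = Set.univ ∧ ∀ a ∈ s.1 \ s.2, ∀ b ∈ s.2 \ s.1, ¬ G.Adj a b

/-- The order `|A ∩ B|` of `(A, B)`. -/
noncomputable def order (s : Set V × Set V) : ℕ∞ := (s.1 ∩ s.2).encard

/-- `(A, B) ≤ (C, D)` if `A ⊆ C` and `D ⊆ B`. -/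
def SepLE (s t : Set V × Set V) : Prop := s.1 ⊆ t.1 ∧ t.2 ⊆ s.2

/-! ### Profiles -/

/-- A profile of `G`: a set of separations that is consistent (P1) and satisfies (P2). -/
structure IsProfile (G : SimpleGraph V) (P : Set (Set V × Set V)) : Prop where
  isSeparation : ∀ s ∈ P, IsSeparation G s
  consistent : ∀ s t, IsSeparation G s → IsSeparation G t → SepLE t s → s ∈ P → t.swap ∉ P
  corner : ∀ s ∈ P, ∀ t ∈ P, (s.2 ∩ t.2, s.1 ∪ t.1) ∉ P

/-- An `ℓ`-profile of `G`, where `ℓ ∈ ℕ ∪ {∞}`. -/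
structure IsProfileOfOrder (G : SimpleGraph V) (ℓ : ℕ∞) (P : Set (Set V × Set V)) : Prop where
  isProfile : IsProfile G P
  order_lt : ∀ s ∈ P, order s < ℓ
  mem_or_swap_mem : ∀ s, IsSeparation G s → order s < ℓ → s ∈ P ∨ s.swap ∈ P

/-- `P` is `n`-robust: for `(A, B) ∈ P` and a separation `(C, D)` of order at most `n`, if
`(B ∩ C, A ∪ D)` and `(B ∩ D, A ∪ C)` both have order less than `|A ∩ B|`, then they do not both
lie in `P`. -/
def IsNRobust (G : SimpleGraph V) (n : ℕ) (P : Set (Set V × Set V)) : Prop :=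
  ∀ s ∈ P, ∀ t, IsSeparation G t → order t ≤ n →
    order (s.2 ∩ t.1, s.1 ∪ t.2) < order s → order (s.2 ∩ t.2, s.1 ∪ t.1) < order s →
    ¬ ((s.2 ∩ t.1, s.1 ∪ t.2) ∈ P ∧ (s.2 ∩ t.2, s.1 ∪ t.1) ∈ P)

/-- `P` is robust: it is `n`-robust for every `n`. -/
def IsRobust (G : SimpleGraph V) (P : Set (Set V × Set V)) : Prop :=
  ∀ n : ℕ, IsNRobust G n P

/-- `s` distinguishes `P` and `P'`. -/
def Distinguishes (s : Set V × Set V) (P P' : Set (Set V × Set V)) : Prop :=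
  (s ∈ P ∧ s.swap ∈ P') ∨ (s.swap ∈ P ∧ s ∈ P')

/-- The separation `s` of `G` distinguishes `P` and `P'` efficiently: no separation of smaller order
distinguishes them. -/
def DistinguishesEfficiently (G : SimpleGraph V) (s : Set V × Set V)
    (P P' : Set (Set V × Set V)) : Prop :=
  IsSeparation G s ∧ Distinguishes s P P' ∧
    ∀ t, IsSeparation G t → Distinguishes t P P' → order s ≤ order t

/-- `P` and `P'` are `k`-distinguishable. -/
def IsDistinguishable (G : SimpleGraph V) (k : ℕ) (P P' : Set (Set V × Set V)) : Prop :=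
  ∃ s, IsSeparation G s ∧ order s ≤ k ∧ Distinguishes s P P'

/-- Every vertex of `G` has finitely many neighbours. -/
def IsLocallyFinite (G : SimpleGraph V) : Prop := ∀ v, (G.neighborSet v).Finite

/-- `G` is a connected locally finite graph and `𝓟` is a set of pairwise `k`-distinguishable robust
profiles of `G`, each of which is an `ℓ`-profile for some `ℓ ∈ ℕ ∪ {∞}`. -/
structure IsAdmissible (k : ℕ) (G : SimpleGraph V) (𝓟 : Set (Set (Set V × Set V))) : Prop where
  connected : G.Connected
  locallyFinite : IsLocallyFinite G
  isProfile : ∀ P ∈ 𝓟, ∃ ℓ : ℕ∞, IsProfileOfOrder G ℓ P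
  robust : ∀ P ∈ 𝓟, IsRobust G P
  distinguishable : 𝓟.Pairwise (IsDistinguishable G k)

/-! ### Tree-decompositions -/

/-- A tree-decomposition `(T, (V_t))` of `G`. -/
structure TreeDecomposition (G : SimpleGraph V) where
  Node : Type u
  tree : SimpleGraph Node
  isTree : tree.IsTree
  part : Node → Set V
  iUnion_part : ⋃ t, part t = Set.univ
  exists_part_of_adj : ∀ v w, G.Adj v w → ∃ t, v ∈ part t ∧ w ∈ part t
  inter_subset : ∀ (t₁ t₂ t₃ : Node) (p : tree.Walk t₁ t₃), p.IsPath → t₂ ∈ p.support →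
    part t₁ ∩ part t₃ ⊆ part t₂

namespace TreeDecomposition

variable {G : SimpleGraph V}

/-- The nodes in the component of `T - st` that contains `s`. -/
def side (D : TreeDecomposition G) (s t : D.Node) : Set D.Node :=
  {u | (D.tree.deleteEdges {s(s, t)}).Reachable s u}

/-- The separation induced by the edge `st` of `T`. -/
def inducedSeparation (D : TreeDecomposition G) (s t : D.Node) : Set V × Set V :=
  (⋃ u ∈ D.side s t, D.part u, ⋃ u ∈ D.side t s, D.part u)

/-- Some separation induced by an edge of `T` distinguishes `P` and `P'` efficiently. -/
def DistinguishesPair (D : TreeDecomposition G) (P P' : Set (Set V × Set V)) : Prop :=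
  ∃ s t, D.tree.Adj s t ∧ DistinguishesEfficiently G (D.inducedSeparation s t) P P'

end TreeDecomposition

/-! ### Canonicity -/

/-- The image of a set of sets of separations under a map of the vertex set. -/
def mapProfiles {V' : Type u} (f : V → V') (𝓟 : Set (Set (Set V × Set V))) :
    Set (Set (Set V' × Set V')) :=
  Set.image (Set.image (Prod.map (Set.image f) (Set.image f))) 𝓟

/-- A construction `ψ` of tree-decompositions of graphs `G` with respect to sets `𝓟`, defined for all
pairs `(G, 𝓟)` with property `C`, is canonical if it commutes with all isomorphisms of such pairs:
every isomorphism `φ : (G, 𝓟) → (G', 𝓟')` induces an isomorphism between the decomposition trees of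
`ψ (G, 𝓟)` and `ψ (G', 𝓟')` that maps a node with part `V_t` to a node with part `φ(V_t)`, and these
induced isomorphisms respect identities and composition. -/
def IsCanonical {C : ∀ ⦃V : Type u⦄, SimpleGraph V → Set (Set (Set V × Set V)) → Prop}
    (ψ : ∀ ⦃V : Type u⦄ (G : SimpleGraph V) (𝓟 : Set (Set (Set V × Set V))),
      C G 𝓟 → TreeDecomposition G) : Prop :=
  ∃ ind : ∀ ⦃V V' : Type u⦄ ⦃G : SimpleGraph V⦄ ⦃G' : SimpleGraph V'⦄
      ⦃𝓟 : Set (Set (Set V × Set V))⦄ ⦃𝓟' : Set (Set (Set V' × Set V'))⦄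
      (h : C G 𝓟) (h' : C G' 𝓟') (φ : G ≃g G'), mapProfiles φ 𝓟 = 𝓟' →
      ((ψ G 𝓟 h).tree ≃g (ψ G' 𝓟' h').tree),
    (∀ ⦃V V' : Type u⦄ ⦃G : SimpleGraph V⦄ ⦃G' : SimpleGraph V'⦄
      ⦃𝓟 : Set (Set (Set V × Set V))⦄ ⦃𝓟' : Set (Set (Set V' × Set V'))⦄
      (h : C G 𝓟) (h' : C G' 𝓟') (φ : G ≃g G') (hφ : mapProfiles φ 𝓟 = 𝓟') (t),
      (ψ G' 𝓟' h').part (ind h h' φ hφ t) = φ '' (ψ G 𝓟 h).part t) ∧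
    (∀ ⦃V : Type u⦄ ⦃G : SimpleGraph V⦄ ⦃𝓟 : Set (Set (Set V × Set V))⦄ (h : C G 𝓟)
      (hid : mapProfiles (SimpleGraph.Iso.refl : G ≃g G) 𝓟 = 𝓟) (t),
      ind h h SimpleGraph.Iso.refl hid t = t) ∧
    (∀ ⦃V V' V'' : Type u⦄ ⦃G : SimpleGraph V⦄ ⦃G' : SimpleGraph V'⦄ ⦃G'' : SimpleGraph V''⦄
      ⦃𝓟 : Set (Set (Set V × Set V))⦄ ⦃𝓟' : Set (Set (Set V' × Set V'))⦄
      ⦃𝓟'' : Set (Set (Set V'' × Set V''))⦄ (h : C G 𝓟) (h' : C G' 𝓟') (h'' : C G'' 𝓟'')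
      (φ : G ≃g G') (χ : G' ≃g G'') (hφ : mapProfiles φ 𝓟 = 𝓟') (hχ : mapProfiles χ 𝓟' = 𝓟'')
      (hc : mapProfiles (φ.trans χ : G ≃g G'') 𝓟 = 𝓟'') (t),
      ind h h'' (φ.trans χ) hc t = ind h' h'' χ hχ (ind h h' φ hφ t))

/-- A construction `ψ` of tree-decompositions, defined for all graphs with property `C`, is canonical
if it commutes with all isomorphisms of such graphs. -/
def IsCanonicalForGraphs {C : ∀ ⦃V : Type u⦄, SimpleGraph V → Prop}
    (ψ : ∀ ⦃V : Type u⦄ (G : SimpleGraph V), C G → TreeDecomposition G) : Prop :=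
  ∃ ind : ∀ ⦃V V' : Type u⦄ ⦃G : SimpleGraph V⦄ ⦃G' : SimpleGraph V'⦄ (h : C G) (h' : C G'),
      G ≃g G' → ((ψ G h).tree ≃g (ψ G' h').tree),
    (∀ ⦃V V' : Type u⦄ ⦃G : SimpleGraph V⦄ ⦃G' : SimpleGraph V'⦄ (h : C G) (h' : C G')
      (φ : G ≃g G') (t), (ψ G' h').part (ind h h' φ t) = φ '' (ψ G h).part t) ∧
    (∀ ⦃V : Type u⦄ ⦃G : SimpleGraph V⦄ (h : C G) (t), ind h h SimpleGraph.Iso.refl t = t) ∧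
    (∀ ⦃V V' V'' : Type u⦄ ⦃G : SimpleGraph V⦄ ⦃G' : SimpleGraph V'⦄ ⦃G'' : SimpleGraph V''⦄
      (h : C G) (h' : C G') (h'' : C G'') (φ : G ≃g G') (χ : G' ≃g G'') (t),
      ind h h'' (φ.trans χ) t = ind h' h'' χ (ind h h' φ t))

/-! ### Ends -/

/-- A ray of `G`: a one-way infinite path. -/
structure Ray (G : SimpleGraph V) where
  vertex : ℕ → V
  injective : Function.Injective vertex
  adj : ∀ n, G.Adj (vertex n) (vertex (n + 1))

/-- All but finitely many vertices of the ray `R` lie in the vertex set `X`. -/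
def Ray.TailIn {G : SimpleGraph V} (R : Ray G) (X : Set V) : Prop :=
  ∀ᶠ n in Filter.atTop, R.vertex n ∈ X

/-- Two rays are equivalent if for every finite vertex set `S` some component of `G - S` contains all
but finitely many vertices of both. -/
def Ray.Equivalent {G : SimpleGraph V} (R R' : Ray G) : Prop :=
  ∀ S : Set V, S.Finite → ∃ K : G.ComponentCompl S, R.TailIn K ∧ R'.TailIn K

/-- `ω` is an end of `G`: an equivalence class of rays. -/
def IsEnd (G : SimpleGraph V) (ω : Set (Ray G)) : Prop :=
  ∃ R, ω = {R' | Ray.Equivalent R R'}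

/-- The end `ω` lies in the component `K` of `G - S`. -/
def LiesIn {G : SimpleGraph V} (ω : Set (Ray G)) {S : Set V} (K : G.ComponentCompl S) : Prop :=
  ∀ R ∈ ω, R.TailIn K

/-- The profile `P_ω` of an end `ω`: the separations `(A, B)` of finite order such that the component
of `G - (A ∩ B)` in which `ω` lies is included in `B`. -/
def endProfile (G : SimpleGraph V) (ω : Set (Ray G)) : Set (Set V × Set V) :=
  {s | IsSeparation G s ∧ (s.1 ∩ s.2).Finite ∧
    ∃ K : G.ComponentCompl (s.1 ∩ s.2), LiesIn ω K ∧ (K : Set V) ⊆ s.2}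

/-- `ω` and `ω'` are distinguishable by at most `k` vertices: they lie in distinct components of
`G - S` for some set `S` of at most `k` vertices. -/
def EndsDistinguishable (G : SimpleGraph V) (k : ℕ) (ω ω' : Set (Ray G)) : Prop :=
  ∃ S : Set V, S.encard ≤ k ∧ ∃ K K' : G.ComponentCompl S, LiesIn ω K ∧ LiesIn ω' K' ∧ K ≠ K'

end CanonicalTD

/-! For each pair of distinct profiles in `𝓟`, consider the set of all separations that distinguish
it efficiently. These have a common order, at most `k`, by which the sets are ranked. It suffices to
choose, without arbitrary choices, a nested set `N` of separations that meets each of these sets,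
and to turn `N` into a tree-decomposition.

The choice is made rank by rank: among the elements of a member that are nested with everything
chosen at lower ranks, take all those that cross the fewest separations of their own rank. Two facts
make this work. Crossing numbers are finite: an efficient distinguisher is tight
(`DistinguishesEfficiently.isTight`), and in a connected locally finite graph a separation of finite
order crosses only finitely many tight separations of bounded order (`finite_isTight_crossing`). And
crossings can be removed by passing to corners. If the orders differ, robustness provides a corner
that replaces the separation of larger order (`exists_corner_of_order_lt`). If they agree,
submodularity both of the order and of the crossing number provides a corner that replaces one of
the two with fewer crossings (`exists_corner_of_order_eq`).

The elements of `N` become the oriented edges of a tree whose nodes are orientations of `N`, and the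
part at a node is the intersection of the sides to which its orientation points. Only finitely many
elements of `N` separate two given vertices; this makes the tree connected and ensures that the
parts cover the graph. Nothing in the construction depends on a choice, so it commutes with
isomorphisms.

For ends, the same construction is applied to the end profiles truncated at order `k`. -/

namespace CanonicalTD

variable {V : Type u}

/-! ### The lattice of separations -/

theorem SepLE.refl (s : Set V × Set V) : SepLE s s := ⟨subset_rfl, subset_rfl⟩

theorem SepLE.trans {r s t : Set V × Set V} (h : SepLE r s) (h' : SepLE s t) : SepLE r t :=
  ⟨h.1.trans h'.1, h'.2.trans h.2⟩

theorem SepLE.antisymm {s t : Set V × Set V} (h : SepLE s t) (h' : SepLE t s) : s = t :=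
  Prod.ext (h.1.antisymm h'.1) (h'.2.antisymm h.2)

theorem SepLE.swap {s t : Set V × Set V} (h : SepLE s t) : SepLE t.swap s.swap := ⟨h.2, h.1⟩

theorem sepLE_swap_iff {s t : Set V × Set V} : SepLE t.swap s.swap ↔ SepLE s t :=
  ⟨fun h => h.swap, fun h => h.swap⟩

/-- The supremum of two separations. -/
def join (s t : Set V × Set V) : Set V × Set V := (s.1 ∪ t.1, s.2 ∩ t.2)

theorem join_comm (s t : Set V × Set V) : join s t = join t s :=
  Prod.ext (Set.union_comm _ _) (Set.inter_comm _ _)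

theorem le_join_left (s t : Set V × Set V) : SepLE s (join s t) :=
  ⟨Set.subset_union_left, Set.inter_subset_left⟩

theorem le_join_right (s t : Set V × Set V) : SepLE t (join s t) :=
  ⟨Set.subset_union_right, Set.inter_subset_right⟩

theorem join_le {r s t : Set V × Set V} (h : SepLE s r) (h' : SepLE t r) : SepLE (join s t) r :=
  ⟨Set.union_subset h.1 h'.1, Set.subset_inter h.2 h'.2⟩

theorem IsSeparation.swap {G : SimpleGraph V} {s : Set V × Set V} (h : IsSeparation G s) :
    IsSeparation G s.swap :=
  ⟨by rw [Set.union_comm]; exact h.1, fun a ha b hb hab => h.2 b hb a ha hab.symm⟩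

theorem IsSeparation.mem_or {G : SimpleGraph V} {s : Set V × Set V} (h : IsSeparation G s) (v : V) :
    v ∈ s.1 ∨ v ∈ s.2 := by
  have : v ∈ s.1 ∪ s.2 := h.1 ▸ Set.mem_univ v
  exact this

theorem IsSeparation.mem_of_adj {G : SimpleGraph V} {s : Set V × Set V} (h : IsSeparation G s)
    {v w : V} (hvw : G.Adj v w) (hv : v ∉ s.2) : w ∈ s.1 := by
  by_contra hw
  exact h.2 v ⟨(h.mem_or v).resolve_right hv, hv⟩ w ⟨(h.mem_or w).resolve_left hw, hw⟩ hvw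

theorem isSeparation_of {G : SimpleGraph V} {s : Set V × Set V} (h : ∀ v, v ∈ s.1 ∨ v ∈ s.2)
    (h' : ∀ v w, G.Adj v w → v ∉ s.2 → w ∈ s.1) : IsSeparation G s :=
  ⟨Set.eq_univ_of_forall h, fun a ha _ hb hab => hb.2 (h' a _ hab ha.2)⟩

theorem IsSeparation.join {G : SimpleGraph V} {s t : Set V × Set V} (hs : IsSeparation G s)
    (ht : IsSeparation G t) : IsSeparation G (join s t) := by
  refine isSeparation_of (fun v => ?_) (fun v w hvw hv => ?_)
  · rcases hs.mem_or v with h | h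
    · exact .inl (.inl h)
    · rcases ht.mem_or v with h' | h'
      · exact .inl (.inr h')
      · exact .inr ⟨h, h'⟩
  · by_cases h : v ∈ s.2
    · exact .inr (ht.mem_of_adj hvw fun h' => hv ⟨h, h'⟩)
    · exact .inl (hs.mem_of_adj hvw h)

@[simp] theorem order_swap (s : Set V × Set V) : order s.swap = order s := by
  simp [order, Set.inter_comm]

/-- Submodularity of the order function. -/
theorem order_join_add_order_join_swap_le (s t : Set V × Set V) :
    order (join s t) + order (join s.swap t.swap) ≤ order s + order t := by
  unfold order
  rw [← Set.encard_union_add_encard_inter, ← Set.encard_union_add_encard_inter (s.1 ∩ s.2)]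
  refine add_le_add (Set.encard_le_encard ?_) (Set.encard_le_encard ?_)
  · intro v; simp only [join, Prod.fst_swap, Prod.snd_swap, Set.mem_union, Set.mem_inter_iff]; tauto
  · intro v; simp only [join, Prod.fst_swap, Prod.snd_swap, Set.mem_union, Set.mem_inter_iff]; tauto

/-! ### Nestedness -/

/-- Two separations are nested if they have comparable orientations. -/
def Nested (s t : Set V × Set V) : Prop :=
  SepLE s t ∨ SepLE s t.swap ∨ SepLE s.swap t ∨ SepLE s.swap t.swap

theorem Nested.symm {s t : Set V × Set V} (h : Nested s t) : Nested t s := by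
  rcases h with h | h | h | h
  · exact .inr (.inr (.inr h.swap))
  · exact .inr (.inl h.swap)
  · exact .inr (.inr (.inl h.swap))
  · exact .inl h.swap

theorem nested_comm {s t : Set V × Set V} : Nested s t ↔ Nested t s := ⟨.symm, .symm⟩

@[simp] theorem nested_swap_left {s t : Set V × Set V} : Nested s.swap t ↔ Nested s t := by
  simp only [Nested, Prod.swap_swap]; tauto

@[simp] theorem nested_swap_right {s t : Set V × Set V} : Nested s t.swap ↔ Nested s t := by
  simp only [Nested, Prod.swap_swap]; tauto

theorem nested_join_left (s t : Set V × Set V) : Nested s (join s t) := .inl (le_join_left s t)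

theorem nested_join_right (s t : Set V × Set V) : Nested t (join s t) := .inl (le_join_right s t)

/-- A separation nested with two crossing separations is nested with their corners. -/
theorem Nested.join {r s t : Set V × Set V} (hst : ¬ Nested s t) (hs : Nested r s)
    (ht : Nested r t) : Nested r (join s t) := by
  rcases hs with h | h | h | h
  · exact .inl (h.trans (le_join_left s t))
  · rcases ht with h' | h' | h' | h'
    · exact .inl (h'.trans (le_join_right s t))
    · exact .inr (.inl (join_le h.swap h'.swap).swap)
    · exact .inr (.inr (.inl (h'.trans (le_join_right s t))))
    · exact absurd (.inr (.inl (h.swap.trans h'))) hst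
  · exact .inr (.inr (.inl (h.trans (le_join_left s t))))
  · rcases ht with h' | h' | h' | h'
    · exact .inl (h'.trans (le_join_right s t))
    · exact absurd (.inr (.inl (h.swap.trans h'))) hst
    · exact .inr (.inr (.inl (h'.trans (le_join_right s t))))
    · exact .inr (.inr (.inr (join_le h.swap h'.swap).swap))

/-- A separation nested with one of two separations is nested with one of two opposite corners. -/
theorem Nested.join_or_join_swap {r s : Set V × Set V} (h : Nested r s) (t : Set V × Set V) :
    Nested r (CanonicalTD.join s t) ∨ Nested r (CanonicalTD.join s.swap t.swap) := by
  rcases h with h | h | h | h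
  · exact .inl (.inl (h.trans (le_join_left _ _)))
  · exact .inr (.inl (h.trans (le_join_left _ _)))
  · exact .inl (.inr (.inr (.inl (h.trans (le_join_left _ _)))))
  · exact .inr (.inr (.inr (.inl (h.trans (le_join_left _ _)))))

/-! ### Nested sets meeting every member of a thinly splintering family -/

section Splinter

variable {S : Type u}

/-- The elements of `U` that cross `a`. -/
def crossing (R : S → S → Prop) (U : Set S) (a : S) : Set S := {b ∈ U | ¬ R a b}

/-- Level `n` of the canonical nested set of a family `𝓐`, where `𝓐 n` is the collection of its
members of rank `n`: the elements of members of rank `n` that are nested with all lower levels and,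
among those in their member, cross as few elements of rank `n` as possible. -/
def splinterLevel (R : S → S → Prop) (𝓐 : ℕ → Set (Set S)) (n : ℕ) : Set S :=
  {a | ∃ X ∈ 𝓐 n, a ∈ X ∧ (∀ m, ∀ _ : m < n, ∀ b ∈ splinterLevel R 𝓐 m, R a b) ∧
    ∀ a' ∈ X, (∀ m, ∀ _ : m < n, ∀ b ∈ splinterLevel R 𝓐 m, R a' b) →
      (crossing R (⋃₀ 𝓐 n) a).ncard ≤ (crossing R (⋃₀ 𝓐 n) a').ncard}
termination_by n

theorem mem_splinterLevel {R : S → S → Prop} {𝓐 : ℕ → Set (Set S)} {n : ℕ} {a : S} :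
    a ∈ splinterLevel R 𝓐 n ↔ ∃ X ∈ 𝓐 n, a ∈ X ∧
      (∀ m < n, ∀ b ∈ splinterLevel R 𝓐 m, R a b) ∧
      ∀ a' ∈ X, (∀ m < n, ∀ b ∈ splinterLevel R 𝓐 m, R a' b) →
        (crossing R (⋃₀ 𝓐 n) a).ncard ≤ (crossing R (⋃₀ 𝓐 n) a').ncard := by
  rw [splinterLevel]; rfl

theorem splinterLevel_subset {R : S → S → Prop} {𝓐 : ℕ → Set (Set S)} {n : ℕ} :
    splinterLevel R 𝓐 n ⊆ ⋃₀ 𝓐 n := by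
  intro a ha
  obtain ⟨X, hX, haX, -⟩ := mem_splinterLevel.1 ha
  exact ⟨X, hX, haX⟩

/-- The family `𝓐` splinters thinly with respect to the nestedness relation `R`. -/
structure SplintersThinly (R : S → S → Prop) (𝓐 : ℕ → Set (Set S)) : Prop where
  symm : ∀ a b, R a b → R b a
  nonempty : ∀ n, ∀ X ∈ 𝓐 n, X.Nonempty
  finite_crossing : ∀ n, ∀ a ∈ ⋃₀ 𝓐 n, ∀ m, (crossing R (⋃₀ 𝓐 m) a).Finite
  of_lt : ∀ m n, m < n → ∀ X ∈ 𝓐 n, ∀ a ∈ X, ∀ b ∈ ⋃₀ 𝓐 m, ¬ R a b →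
    ∃ c ∈ X, R c b ∧ ∀ d, R d a → R d b → R d c
  of_eq : ∀ n, ∀ X ∈ 𝓐 n, ∀ Y ∈ 𝓐 n, ∀ a ∈ X, ∀ b ∈ Y, ¬ R a b →
    ∃ c, (∀ d, R d a → R d b → R d c) ∧
      (c ∈ X ∧ (crossing R (⋃₀ 𝓐 n) c).ncard < (crossing R (⋃₀ 𝓐 n) a).ncard ∨
       c ∈ Y ∧ (crossing R (⋃₀ 𝓐 n) c).ncard < (crossing R (⋃₀ 𝓐 n) b).ncard)

/-- Different levels are nested by construction. If two elements of one level cross, the element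
supplied by `of_eq` is still nested with all lower levels, so it competes with one of them and
contradicts the minimality of its crossing number. -/
theorem SplintersThinly.nested {R : S → S → Prop} {𝓐 : ℕ → Set (Set S)}
    (h : SplintersThinly R 𝓐) {m n : ℕ} {a b : S} (ha : a ∈ splinterLevel R 𝓐 m)
    (hb : b ∈ splinterLevel R 𝓐 n) : R a b := by
  obtain ⟨X, hX, haX, hal, ham⟩ := mem_splinterLevel.1 ha
  obtain ⟨Y, hY, hbY, hbl, hbm⟩ := mem_splinterLevel.1 hb
  rcases lt_trichotomy m n with hmn | rfl | hmn
  · exact h.symm _ _ (hbl m hmn a ha)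
  · by_contra hab
    obtain ⟨c, hc, hc'⟩ := h.of_eq m X hX Y hY a haX b hbY hab
    have hcl : ∀ l < m, ∀ d ∈ splinterLevel R 𝓐 l, R c d := fun l hl d hd =>
      h.symm _ _ (hc d (h.symm _ _ (hal l hl d hd)) (h.symm _ _ (hbl l hl d hd)))
    rcases hc' with ⟨hcX, hlt⟩ | ⟨hcY, hlt⟩
    · exact (ham c hcX hcl).not_gt hlt
    · exact (hbm c hcY hcl).not_gt hlt
  · exact hal n hmn b hb

theorem SplintersThinly.exists_mem {R : S → S → Prop} {𝓐 : ℕ → Set (Set S)}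
    (h : SplintersThinly R 𝓐) {n : ℕ} {X : Set S} (hX : X ∈ 𝓐 n) :
    ∃ a ∈ X, a ∈ splinterLevel R 𝓐 n := by
  have key : ∃ a ∈ X, ∀ m < n, ∀ b ∈ splinterLevel R 𝓐 m, R a b := by
    let L : Set S := ⋃ m ∈ Set.Iio n, splinterLevel R 𝓐 m
    have hfin : ∀ a ∈ X, (crossing R L a).Finite := by
      intro a ha
      refine Set.Finite.subset ((Set.finite_Iio n).biUnion fun m _ =>
        h.finite_crossing n a ⟨X, hX, ha⟩ m) ?_
      rintro b ⟨hb, hab⟩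
      obtain ⟨m, hm, hbm⟩ := Set.mem_iUnion₂.1 hb
      exact Set.mem_iUnion₂.2 ⟨m, hm, splinterLevel_subset hbm, hab⟩
    -- An element of `X` crossing as few chosen elements of lower rank as possible crosses none: if
    -- it crossed `b`, then `of_lt` would give an element nested with `b` that crosses nothing new,
    -- since the lower levels are nested with `b`.
    obtain ⟨a, haX, hmin⟩ := exists_minimalFor_of_wellFoundedLT (· ∈ X)
      (fun a => (crossing R L a).ncard) (h.nonempty n X hX)
    refine ⟨a, haX, fun m hm b hb => ?_⟩
    by_contra hab
    obtain ⟨c, hcX, hcb, hc⟩ := h.of_lt m n hm X hX a haX b (splinterLevel_subset hb) hab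
    have hbL : b ∈ L := Set.mem_iUnion₂.2 ⟨m, hm, hb⟩
    have hsub : crossing R L c ⊆ crossing R L a := by
      rintro d ⟨hd, hcd⟩
      refine ⟨hd, fun had => hcd ?_⟩
      obtain ⟨l, -, hdl⟩ := Set.mem_iUnion₂.1 hd
      exact h.symm _ _ (hc d (h.symm _ _ had) (h.nested hdl hb))
    have hlt : (crossing R L c).ncard < (crossing R L a).ncard :=
      Set.ncard_lt_ncard ⟨hsub, fun hsub' => (hsub' ⟨hbL, hab⟩).2 hcb⟩ (hfin a haX)
    exact (hmin hcX hlt.le).not_gt hlt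
  obtain ⟨a, ⟨haX, hal⟩, hmin⟩ := exists_minimalFor_of_wellFoundedLT
    (fun a => a ∈ X ∧ ∀ m < n, ∀ b ∈ splinterLevel R 𝓐 m, R a b)
    (fun a => (crossing R (⋃₀ 𝓐 n) a).ncard) key
  refine ⟨a, haX, mem_splinterLevel.2 ⟨X, hX, haX, hal, fun a' ha' hal' => ?_⟩⟩
  exact (le_total _ _).elim id fun hle => hmin ⟨ha', hal'⟩ hle

/-- Used twice: with a graph isomorphism for canonicity, and with `Prod.swap` for closure under
reversing orientation. -/
theorem splinterLevel_image {S' : Type u} (e : S ≃ S') {R : S → S → Prop} {R' : S' → S' → Prop}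
    (hR : ∀ a b, R' (e a) (e b) ↔ R a b) {𝓐 : ℕ → Set (Set S)} {𝓐' : ℕ → Set (Set S')}
    (h𝓐 : ∀ n, 𝓐' n = Set.image e '' 𝓐 n) (n : ℕ) :
    splinterLevel R' 𝓐' n = e '' splinterLevel R 𝓐 n := by
  have hcr : ∀ m a, (crossing R' (⋃₀ 𝓐' m) (e a)).ncard = (crossing R (⋃₀ 𝓐 m) a).ncard := by
    intro m a
    rw [← Set.ncard_image_of_injective _ e.injective]
    congr 1
    ext b
    obtain ⟨b, rfl⟩ := e.surjective b
    simp [crossing, hR, h𝓐]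
  induction n using Nat.strong_induction_on with
  | _ n ih =>
    have hl : ∀ a, (∀ m < n, ∀ b ∈ splinterLevel R' 𝓐' m, R' (e a) b) ↔
        ∀ m < n, ∀ b ∈ splinterLevel R 𝓐 m, R a b := by
      refine fun a => forall₂_congr fun m hm => ?_
      rw [ih m hm, Set.forall_mem_image]
      simp only [hR]
    ext a
    obtain ⟨a, rfl⟩ := e.surjective a
    rw [e.injective.mem_set_image, mem_splinterLevel, mem_splinterLevel, h𝓐 n, Set.exists_mem_image]
    refine exists_congr fun X => and_congr_right fun _ => ?_
    rw [e.injective.mem_set_image, hl, Set.forall_mem_image]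
    simp only [hl, ← h𝓐 n, hcr]

end Splinter

variable {G : SimpleGraph V}

/-! ### Connectedness and separators -/

theorem eq_empty_or_univ_of_adj_closed (hG : G.Connected) {Z : Set V}
    (hZ : ∀ v ∈ Z, ∀ w, G.Adj v w → w ∈ Z) : Z = ∅ ∨ Z = Set.univ := by
  rcases Z.eq_empty_or_nonempty with h | ⟨z, hz⟩
  · exact .inl h
  · refine .inr (Set.eq_univ_of_forall fun w => ?_)
    obtain ⟨p⟩ := hG.preconnected z w
    induction p with
    | nil => exact hz
    | cons hadj _ ih => exact ih (hZ _ hz _ hadj)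

/-- A walk between the two sides of a separation meets the separator. -/
theorem IsSeparation.exists_mem_support {s : Set V × Set V} (hs : IsSeparation G s) {v w : V}
    (p : G.Walk v w) (hv : v ∈ s.1) (hw : w ∈ s.2) : ∃ z ∈ p.support, z ∈ s.1 ∩ s.2 := by
  induction p with
  | nil => exact ⟨_, by simp, hv, hw⟩
  | cons hadj p ih =>
    rename_i a b c
    by_cases ha : a ∈ s.2
    · exact ⟨a, by simp, hv, ha⟩
    · obtain ⟨z, hz, hz'⟩ := ih (hs.mem_of_adj hadj ha) hw
      exact ⟨z, by simp [hz], hz'⟩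

/-- `v` can be reached from `u` by a walk whose vertices after `u` avoid `Y`. -/
def ReachAvoiding (G : SimpleGraph V) (Y : Set V) : V → V → Prop :=
  Relation.ReflTransGen fun a b => G.Adj a b ∧ b ∉ Y

namespace ReachAvoiding

variable {Y W : Set V} {u v w : V}

theorem mono (h : ReachAvoiding G Y u v) (hW : W ⊆ Y) : ReachAvoiding G W u v :=
  Relation.ReflTransGen.mono (fun _ _ hab => ⟨hab.1, fun hb => hab.2 (hW hb)⟩) _ _ h

theorem trans (h : ReachAvoiding G Y u v) (h' : ReachAvoiding G Y v w) : ReachAvoiding G Y u w :=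
  Relation.ReflTransGen.trans h h'

theorem notMem (h : ReachAvoiding G Y u v) (hu : u ∉ Y) : v ∉ Y := by
  induction h with
  | refl => exact hu
  | tail _ hab _ => exact hab.2

theorem symm (h : ReachAvoiding G Y u v) (hu : u ∉ Y) : ReachAvoiding G Y v u := by
  induction h with
  | refl => exact .refl
  | tail h hab ih => exact .head ⟨hab.1.symm, notMem h hu⟩ ih

theorem mem_diff {s : Set V × Set V} (hs : IsSeparation G s)
    (h : ReachAvoiding G (s.1 ∩ s.2) u v) (hu : u ∈ s.1 \ s.2) : v ∈ s.1 \ s.2 := by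
  induction h with
  | refl => exact hu
  | tail _ hab ih =>
    have := hs.mem_of_adj hab.1 ih.2
    exact ⟨this, fun h => hab.2 ⟨this, h⟩⟩

theorem exists_finite (h : ReachAvoiding G W u v) :
    ∃ F : Set V, F.Finite ∧ Disjoint F W ∧ ∀ Y, Disjoint F Y → ReachAvoiding G Y u v := by
  induction h with
  | refl => exact ⟨∅, Set.finite_empty, by simp, fun _ _ => .refl⟩
  | tail _ hab ih =>
    obtain ⟨F, hF, hFW, hFY⟩ := ih
    rename_i b c _
    refine ⟨insert c F, hF.insert c, ?_, fun Y hY => ?_⟩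
    · rw [Set.disjoint_insert_left]; exact ⟨hab.2, hFW⟩
    · rw [Set.disjoint_insert_left] at hY
      exact .tail (hFY Y hY.2) ⟨hab.1, hY.1⟩

end ReachAvoiding

/-- `Y` separates `u` from `v` minimally. -/
structure IsTightSeparator (G : SimpleGraph V) (u v : V) (Y : Set V) : Prop where
  left_notMem : u ∉ Y
  right_notMem : v ∉ Y
  left : ∀ y ∈ Y, ∃ z, ReachAvoiding G Y u z ∧ G.Adj z y
  right : ∀ y ∈ Y, ∃ z, ReachAvoiding G Y v z ∧ G.Adj z y
  not_reach : ¬ ReachAvoiding G Y u v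

/-- A bounded search tree. If `W` does not yet separate `u` from `v`, then `Y` contains one of the
finitely many vertices of a fixed walk avoiding `W`, and that vertex is added to `W`. If `W` already
separates them, then `Y = W`, as a further vertex of `Y` would link `u` to `v` around `W`. -/
theorem finite_isTightSeparator_superset (u v : V) (n : ℕ) (W : Set V) :
    {Y | W ⊆ Y ∧ (Y \ W).encard ≤ n ∧ IsTightSeparator G u v Y}.Finite := by
  induction n generalizing W with
  | zero =>
    refine (Set.finite_singleton W).subset ?_
    rintro Y ⟨hWY, hcard, -⟩
    have : Y \ W = ∅ := by simpa using hcard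
    exact (Set.sdiff_eq_empty.1 this).antisymm hWY
  | succ n ih =>
    by_cases huv : ReachAvoiding G W u v
    · obtain ⟨F, hF, hFW, hFY⟩ := huv.exists_finite
      refine (hF.biUnion fun w _ => ih (insert w W)).subset ?_
      rintro Y ⟨hWY, hcard, hY⟩
      have : ¬ Disjoint F Y := fun h => hY.not_reach (hFY Y h)
      obtain ⟨w, hwF, hwY⟩ := Set.not_disjoint_iff.1 this
      refine Set.mem_iUnion₂.2 ⟨w, hwF, Set.insert_subset hwY hWY, ?_, hY⟩
      have hw : w ∈ Y \ W := ⟨hwY, Set.disjoint_left.1 hFW hwF⟩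
      have h1 := Set.encard_sdiff_singleton_add_one hw
      rw [Set.sdiff_sdiff, Set.union_comm, Set.singleton_union] at h1
      rw [← h1] at hcard
      push_cast at hcard
      exact (ENat.add_le_add_iff_right (by simp)).1 hcard
    · refine (Set.finite_singleton W).subset ?_
      rintro Y ⟨hWY, -, hY⟩
      refine Set.Subset.antisymm (fun w hw => ?_) hWY
      by_contra hwW
      obtain ⟨z, hz, hzw⟩ := hY.left w hw
      obtain ⟨z', hz', hzw'⟩ := hY.right w hw
      refine huv (.trans (hz.mono hWY) (.head ⟨hzw, hwW⟩ (.head ⟨hzw'.symm, fun h => ?_⟩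
        ((hz'.symm hY.right_notMem).mono hWY))))
      exact hz'.notMem hY.right_notMem (hWY h)

theorem finite_isTightSeparator (u v : V) (n : ℕ) :
    {Y : Set V | Y.encard ≤ n ∧ IsTightSeparator G u v Y}.Finite :=
  (finite_isTightSeparator_superset (G := G) u v n ∅).subset fun _ hY => by
    simpa using hY

/-- A separation is tight if on either side some component of the graph minus the separator has the
entire separator as its neighbourhood. -/
def IsTight (G : SimpleGraph V) (s : Set V × Set V) : Prop :=
  IsSeparation G s ∧ ∃ u ∈ s.1 \ s.2, ∃ v ∈ s.2 \ s.1, IsTightSeparator G u v (s.1 ∩ s.2)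

theorem IsTight.not_subset {s : Set V × Set V} (h : IsTight G s) : ¬ s.1 ⊆ s.2 := by
  obtain ⟨-, u, hu, -⟩ := h
  exact fun h' => hu.2 (h' hu.1)

theorem IsTightSeparator.symm {u v : V} {Y : Set V} (h : IsTightSeparator G u v Y) :
    IsTightSeparator G v u Y :=
  ⟨h.right_notMem, h.left_notMem, h.right, h.left, fun h' => h.not_reach (h'.symm h.right_notMem)⟩

theorem IsTight.swap {s : Set V × Set V} (h : IsTight G s) : IsTight G s.swap := by
  obtain ⟨hs, u, hu, v, hv, h⟩ := h
  refine ⟨hs.swap, v, hv, u, hu, ?_⟩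
  have := h.symm
  rwa [Set.inter_comm] at this

/-- A separation of a connected graph is determined by its separator and the neighbours of its
separator on one side. -/
theorem IsSeparation.fst_subset_of_inter_eq (hG : G.Connected) {s t : Set V × Set V}
    (hs : IsSeparation G s) (ht : IsSeparation G t) (hst : s.1 ∩ s.2 = t.1 ∩ t.2)
    (hne : (s.1 ∩ s.2).Nonempty)
    (hnb : s.1 ∩ {w | ∃ y ∈ s.1 ∩ s.2, G.Adj y w} ⊆ t.1) : s.1 ⊆ t.1 := by
  have hclosed : ∀ v ∈ s.1 \ t.1, ∀ w, G.Adj v w → w ∈ s.1 \ t.1 := by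
    rintro v ⟨hv, hvt⟩ w hvw
    have hwY : w ∉ s.1 ∩ s.2 := fun hw => hvt (hnb ⟨hv, w, hw, hvw.symm⟩)
    have hvs : v ∉ s.2 := fun h => hvt (hst.subset ⟨hv, h⟩).1
    refine ⟨hs.mem_of_adj hvw hvs, fun hwt => hwY ?_⟩
    rw [hst]
    exact ⟨hwt, ht.swap.mem_of_adj hvw hvt⟩
  rcases eq_empty_or_univ_of_adj_closed hG hclosed with h | h
  · exact Set.sdiff_eq_empty.1 h
  · obtain ⟨y, hy⟩ := hne
    have : y ∈ s.1 \ t.1 := h ▸ Set.mem_univ y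
    exact absurd (hst.subset hy).1 this.2

theorem IsSeparation.snd_eq {s : Set V × Set V} (hs : IsSeparation G s) :
    s.2 = s.1ᶜ ∪ (s.1 ∩ s.2) := by
  ext v
  have := hs.mem_or v
  simp only [Set.mem_union, Set.mem_compl_iff, Set.mem_inter_iff]
  tauto

/-- The separation is determined by which neighbours of `Y` lie in its first side, and there are
only finitely many such neighbours. -/
theorem finite_isSeparation_inter_eq (hG : G.Connected) (hlf : IsLocallyFinite G) {Y : Set V}
    (hY : Y.Finite) (hne : Y.Nonempty) :
    {s : Set V × Set V | IsSeparation G s ∧ s.1 ∩ s.2 = Y}.Finite := by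
  have hF : {w | ∃ y ∈ Y, G.Adj y w}.Finite :=
    (hY.biUnion fun y _ => hlf y).subset fun w ⟨y, hy, hyw⟩ => Set.mem_iUnion₂.2 ⟨y, hy, hyw⟩
  refine Set.Finite.of_finite_image (f := fun s => s.1 ∩ {w | ∃ y ∈ Y, G.Adj y w})
    (hF.finite_subsets.subset ?_) ?_
  · rintro _ ⟨s, -, rfl⟩
    exact Set.inter_subset_right
  · rintro s ⟨hs, hsY⟩ t ⟨ht, htY⟩ hst
    have h1 : s.1 = t.1 := by
      refine (hs.fst_subset_of_inter_eq hG ht (hsY.trans htY.symm) (hsY ▸ hne) ?_).antisymm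
        (ht.fst_subset_of_inter_eq hG hs (htY.trans hsY.symm) (htY ▸ hne) ?_)
      · rw [hsY]; exact hst.subset.trans Set.inter_subset_left
      · rw [htY]; exact hst.superset.trans Set.inter_subset_left
    exact Prod.ext h1 (by rw [hs.snd_eq, ht.snd_eq, hsY, htY, h1])

/-- The separator of a tight separation through `y` also separates minimally two neighbours of `y`,
one in each full component. Local finiteness leaves finitely many pairs of neighbours, hence
finitely many separators. -/
theorem finite_isTight_mem (hG : G.Connected) (hlf : IsLocallyFinite G) (n : ℕ) (y : V) :
    {s | IsTight G s ∧ order s ≤ n ∧ y ∈ s.1 ∩ s.2}.Finite := by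
  have h1 : {Y : Set V | Y.encard ≤ n ∧ y ∈ Y ∧ ∃ u v, IsTightSeparator G u v Y}.Finite := by
    refine ((hlf y).biUnion fun u _ => (hlf y).biUnion fun v _ =>
      finite_isTightSeparator (G := G) u v n).subset ?_
    rintro Y ⟨hcard, hy, u, v, h⟩
    obtain ⟨z, hz, hzy⟩ := h.left y hy
    obtain ⟨z', hz', hzy'⟩ := h.right y hy
    refine Set.mem_iUnion₂.2 ⟨z, hzy.symm, Set.mem_iUnion₂.2 ⟨z', hzy'.symm, hcard, ?_⟩⟩
    refine ⟨hz.notMem h.left_notMem, hz'.notMem h.right_notMem, fun x hx => ?_, fun x hx => ?_,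
      fun hr => h.not_reach ((hz.trans hr).trans (hz'.symm h.right_notMem))⟩
    · obtain ⟨x', hx', hadj⟩ := h.left x hx
      exact ⟨x', (hz.symm h.left_notMem).trans hx', hadj⟩
    · obtain ⟨x', hx', hadj⟩ := h.right x hx
      exact ⟨x', (hz'.symm h.right_notMem).trans hx', hadj⟩
  refine (h1.biUnion (t := fun Y => {s : Set V × Set V | IsSeparation G s ∧ s.1 ∩ s.2 = Y})
    fun Y hY => finite_isSeparation_inter_eq hG hlf ?_ ⟨y, hY.2.1⟩).subset ?_
  · exact Set.finite_of_encard_le_coe hY.1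
  · rintro s ⟨⟨hs, u, hu, v, hv, h⟩, hord, hy⟩
    exact Set.mem_iUnion₂.2 ⟨s.1 ∩ s.2, ⟨hord, hy, u, v, h⟩, hs, rfl⟩

/-- Only finitely many tight separations of bounded order separate two given vertices. -/
theorem finite_isTight_separating (hG : G.Connected) (hlf : IsLocallyFinite G) (n : ℕ) (v w : V) :
    {s | IsTight G s ∧ order s ≤ n ∧ v ∈ s.1 ∧ w ∈ s.2}.Finite := by
  obtain ⟨p⟩ := hG.preconnected v w
  refine (p.support.finite_toSet.biUnion fun z _ => finite_isTight_mem hG hlf n z).subset ?_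
  rintro s ⟨hs, hord, hv, hw⟩
  obtain ⟨z, hz, hz'⟩ := hs.1.exists_mem_support p hv hw
  exact Set.mem_iUnion₂.2 ⟨z, hz, hs, hord, hz'⟩

/-- As `t.2` avoids the separator of `s`, the full component of `t` in `t.2` lies on one side of
`s`, and so does its neighbourhood, the separator of `t`. By connectedness all of `t.2` follows,
since what is left of it would be closed under adjacency. -/
theorem IsTight.nested_of_subset_diff (hG : G.Connected) {s t : Set V × Set V}
    (hs : IsSeparation G s) (ht : IsTight G t) (hst : s.1 ∩ s.2 ⊆ t.1 \ t.2) : Nested s t := by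
  obtain ⟨htsep, u, -, v, hv, h⟩ := ht
  wlog hvs : v ∈ s.1 generalizing s
  · rw [← nested_swap_left]
    exact this hs.swap (by rwa [Set.inter_comm] at hst) ((hs.mem_or v).resolve_left hvs)
  have hX : ∀ x ∈ t.2, x ∈ s.1 → x ∉ s.2 := fun x hx h1 h2 => (hst ⟨h1, h2⟩).2 hx
  have hstep : ∀ x ∈ s.1, x ∈ t.2 → ∀ y ∈ t.2, G.Adj x y → y ∈ s.1 := fun x hx hx' y _ hxy =>
    hs.mem_of_adj hxy (hX x hx' hx)
  have hK : ∀ z, ReachAvoiding G (t.1 ∩ t.2) v z → z ∈ t.2 \ t.1 ∧ z ∈ s.1 := by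
    intro z hz
    induction hz with
    | refl => exact ⟨hv, hvs⟩
    | tail _ hab ih =>
      have h2 := htsep.swap.mem_of_adj hab.1 ih.1.2
      exact ⟨⟨h2, fun h => hab.2 ⟨h, h2⟩⟩, hstep _ ih.2 ih.1.1 _ h2 hab.1⟩
  have hY : t.1 ∩ t.2 ⊆ s.1 := by
    intro y hy
    obtain ⟨z, hz, hzy⟩ := h.right y hy
    exact hstep z (hK z hz).2 (hK z hz).1.1 y hy.2 hzy
  have hclosed : ∀ a ∈ t.2 \ s.1, ∀ b, G.Adj a b → b ∈ t.2 \ s.1 := by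
    rintro a ⟨hat, has⟩ b hab
    have hb : b ∈ t.2 := htsep.swap.mem_of_adj hab fun h => has (hY ⟨h, hat⟩)
    exact ⟨hb, fun hbs => has (hstep b hbs hb a hat hab.symm)⟩
  have hD : t.2 ⊆ s.1 := by
    rcases eq_empty_or_univ_of_adj_closed hG hclosed with h | h
    · exact Set.sdiff_eq_empty.1 h
    · have : v ∈ t.2 \ s.1 := h ▸ Set.mem_univ v
      exact absurd hvs this.2
  refine Nested.symm (.inr (.inr (.inl ⟨hD, fun x hx => ?_⟩)))
  exact (htsep.mem_or x).elim id fun hx' => absurd hx (hX x hx' (hD hx'))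

/-- A separation of finite order crosses only finitely many tight separations of bounded order. -/
theorem finite_isTight_crossing (hG : G.Connected) (hlf : IsLocallyFinite G) (n : ℕ)
    {s : Set V × Set V} (hs : IsSeparation G s) (hfin : (s.1 ∩ s.2).Finite) :
    {t | IsTight G t ∧ order t ≤ n ∧ ¬ Nested s t}.Finite := by
  obtain ⟨r⟩ := hG.nonempty
  have p : ∀ x, G.Walk r x := fun x => (hG.preconnected r x).some
  have hX : (⋃ x ∈ s.1 ∩ s.2, {z | z ∈ (p x).support}).Finite :=
    hfin.biUnion fun x _ => (p x).support.finite_toSet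
  -- The walks from `r` to the separator of `s` form a finite set. A tight separation whose
  -- separator misses this set has the whole separator of `s` strictly on the side of `r`, and is
  -- then nested with `s`.
  refine ((hX.insert r).biUnion fun z _ => finite_isTight_mem hG hlf n z).subset ?_
  rintro t ⟨ht, hord, hst⟩
  by_contra hcon
  have hmeet : ∀ z ∈ insert r (⋃ x ∈ s.1 ∩ s.2, {z | z ∈ (p x).support}), z ∉ t.1 ∩ t.2 :=
    fun z hz hz' => hcon (Set.mem_iUnion₂.2 ⟨z, hz, ht, hord, hz'⟩)
  have hwalk : ∀ t' : Set V × Set V, IsSeparation G t' → t'.1 ∩ t'.2 = t.1 ∩ t.2 → r ∈ t'.1 →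
      s.1 ∩ s.2 ⊆ t'.1 \ t'.2 := by
    intro t' ht' htt' hr x hx
    have hx2 : x ∉ t'.2 := by
      intro hx2
      obtain ⟨z, hz, hz'⟩ := ht'.exists_mem_support (p x) hr hx2
      exact hmeet z (.inr (Set.mem_iUnion₂.2 ⟨x, hx, hz⟩)) (htt' ▸ hz')
    exact ⟨(ht'.mem_or x).resolve_right hx2, hx2⟩
  rcases ht.1.mem_or r with hr | hr
  · exact hst (ht.nested_of_subset_diff hG hs (hwalk t ht.1 rfl hr))
  · exact hst (nested_swap_right.1 (ht.swap.nested_of_subset_diff hG hs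
      (hwalk t.swap ht.1.swap (Set.inter_comm _ _) hr)))

/-! ### Profiles -/

namespace IsProfileOfOrder

variable {ℓ : ℕ∞} {P : Set (Set V × Set V)} {s t : Set V × Set V}

theorem swap_notMem (hP : IsProfileOfOrder G ℓ P) (hs : s ∈ P) : s.swap ∉ P :=
  hP.isProfile.consistent s s (hP.isProfile.isSeparation s hs) (hP.isProfile.isSeparation s hs)
    (SepLE.refl s) hs

/-- Otherwise `s.swap ≤ s`, and (P1) would exclude `s` itself. -/
theorem not_subset (hP : IsProfileOfOrder G ℓ P) (hs : s ∈ P) : ¬ s.2 ⊆ s.1 := fun h =>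
  have hsep := hP.isProfile.isSeparation s hs
  hP.isProfile.consistent s s.swap hsep hsep.swap ⟨h, h⟩ hs hs

theorem mem_of_le (hP : IsProfileOfOrder G ℓ P) (hs : s ∈ P) (ht : IsSeparation G t)
    (hts : SepLE t s) (hord : order t < ℓ) : t ∈ P :=
  (hP.mem_or_swap_mem t ht hord).resolve_right
    (hP.isProfile.consistent s t (hP.isProfile.isSeparation s hs) ht hts hs)

theorem join_mem (hP : IsProfileOfOrder G ℓ P) (hs : s ∈ P) (ht : t ∈ P)
    (hord : order (join s t) < ℓ) : join s t ∈ P :=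
  (hP.mem_or_swap_mem _ ((hP.isProfile.isSeparation s hs).join (hP.isProfile.isSeparation t ht))
    hord).resolve_right (hP.isProfile.corner s hs t ht)

theorem finite_inter (hP : IsProfileOfOrder G ℓ P) (hs : s ∈ P) : (s.1 ∩ s.2).Finite :=
  Set.encard_lt_top_iff.1 ((hP.order_lt s hs).trans_le le_top)

theorem mem_or_swap_mem_of_order_le (hP : IsProfileOfOrder G ℓ P) (hs : s ∈ P)
    (ht : IsSeparation G t) (hord : order t ≤ order s) : t ∈ P ∨ t.swap ∈ P :=
  hP.mem_or_swap_mem t ht (hord.trans_lt (hP.order_lt s hs))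

end IsProfileOfOrder

namespace DistinguishesEfficiently

variable {P P' : Set (Set V × Set V)} {s : Set V × Set V}

theorem symm (h : DistinguishesEfficiently G s P P') : DistinguishesEfficiently G s P' P :=
  ⟨h.1, h.2.1.elim (fun h => .inr ⟨h.2, h.1⟩) fun h => .inl ⟨h.2, h.1⟩, fun t ht htd =>
    h.2.2 t ht (htd.elim (fun h => .inr ⟨h.2, h.1⟩) fun h => .inl ⟨h.2, h.1⟩)⟩

theorem swap (h : DistinguishesEfficiently G s P P') : DistinguishesEfficiently G s.swap P P' :=
  ⟨h.1.swap, h.2.1.elim .inr .inl, fun t ht htd => (order_swap s).trans_le (h.2.2 t ht htd)⟩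

theorem mem_cases (h : DistinguishesEfficiently G s P P') :
    s ∈ P ∧ s.swap ∈ P' ∨ s ∈ P' ∧ s.swap ∈ P :=
  h.2.1.elim .inl fun h => .inr h.symm

theorem order_eq {t : Set V × Set V} (h : DistinguishesEfficiently G s P P')
    (h' : DistinguishesEfficiently G t P P') : order s = order t :=
  (h.2.2 t h'.1 h'.2.1).antisymm (h'.2.2 s h.1 h.2.1)

/-- A corner of small order of an efficient distinguisher is again one. -/
theorem join {t : Set V × Set V} {ℓ ℓ' : ℕ∞} (hP : IsProfileOfOrder G ℓ P)
    (hP' : IsProfileOfOrder G ℓ' P') (h : DistinguishesEfficiently G s P P') (hs : s ∈ P)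
    (hs' : s.swap ∈ P') (ht : t ∈ P) (hord : order (join s t) ≤ order s) :
    DistinguishesEfficiently G (join s t) P P' := by
  have hsep := h.1.join (hP.isProfile.isSeparation t ht)
  refine ⟨hsep, .inl ⟨hP.join_mem hs ht (hord.trans_lt (hP.order_lt s hs)), ?_⟩,
    fun r hr hrd => hord.trans (h.2.2 r hr hrd)⟩
  refine hP'.mem_of_le hs' hsep.swap (le_join_left s t).swap ?_
  rw [order_swap]
  exact (hord.trans_eq (order_swap s).symm).trans_lt (hP'.order_lt _ hs')

/-- The side of an efficient distinguisher to which a profile points contains a component whose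
neighbourhood is the entire separator. -/
theorem exists_full_component {ℓ ℓ' : ℕ∞} (hG : G.Connected) (hlf : IsLocallyFinite G)
    (hP : IsProfileOfOrder G ℓ P) (hP' : IsProfileOfOrder G ℓ' P')
    (h : DistinguishesEfficiently G s P P') (hs : s ∈ P) (hs' : s.swap ∈ P') :
    ∃ x ∈ s.2 \ s.1, ∀ y ∈ s.1 ∩ s.2, ∃ z, ReachAvoiding G (s.1 ∩ s.2) x z ∧ G.Adj z y := by
  classical
  set Y := s.1 ∩ s.2 with hY
  have hYfin : Y.Finite := hP.finite_inter hs
  let K : V → Set V := fun x => {z | ReachAvoiding G Y x z}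
  let N : V → Set V := fun x => {y ∈ Y | ∃ z ∈ K x, G.Adj z y}
  have hKs : ∀ x ∈ s.2 \ s.1, K x ⊆ s.2 \ s.1 := fun x hx z hz =>
    ReachAvoiding.mem_diff h.1.swap (by rw [Prod.fst_swap, Prod.snd_swap, Set.inter_comm]; exact hz)
      hx
  have hKY : ∀ x ∈ s.2 \ s.1, ∀ z ∈ K x, z ∉ Y := fun x hx z hz hzY => (hKs x hx hz).2 hzY.1
  have hsep : ∀ x ∈ s.2 \ s.1, IsSeparation G (K x ∪ N x, (K x)ᶜ) := by
    intro x hx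
    refine isSeparation_of (fun v => ?_) fun v w hvw hv => ?_
    · by_cases hv : v ∈ K x
      · exact .inl (.inl hv)
      · exact .inr hv
    · have hvK : v ∈ K x := not_not.1 hv
      by_cases hw : w ∈ Y
      · exact .inr ⟨hw, v, hvK, hvw⟩
      · exact .inl (.tail hvK ⟨hvw, hw⟩)
  have hordN : ∀ x ∈ s.2 \ s.1, order (K x ∪ N x, (K x)ᶜ) = (N x).encard := by
    intro x hx
    have hdisj : ∀ z ∈ N x, z ∉ K x := fun z hz hzK => hKY x hx z hzK hz.1
    unfold order
    congr 1
    ext z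
    have := hdisj z
    simp only [Set.mem_inter_iff, Set.mem_union, Set.mem_compl_iff]
    tauto
  have hNle : ∀ x, (N x).encard ≤ order s := fun x => Set.encard_le_encard fun y hy => hy.1
  -- Suppose no component `K x` is full. Then each `(K x ∪ N x, (K x)ᶜ)` has order below that of
  -- `s`, so `P` and `P'` orient it alike, which forces it into `P`. Joining these to `s` by (P2)
  -- absorbs all of `s.2 \ s.1` into the first side, which no profile allows.
  by_contra! hcon
  have hmem : ∀ x ∈ s.2 \ s.1, (K x ∪ N x, (K x)ᶜ) ∈ P := by
    intro x hx
    have hle : order (K x ∪ N x, (K x)ᶜ) ≤ order s := (hordN x hx).trans_le (hNle x)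
    refine (hP.mem_or_swap_mem_of_order_le hs (hsep x hx) hle).resolve_right fun hmem => ?_
    obtain ⟨y, hy, hyN⟩ := hcon x hx
    have hlt : (N x).encard < order s := by
      refine (hYfin.subset fun y hy => hy.1).encard_lt_encard ⟨fun y hy => hy.1, fun hsub => ?_⟩
      obtain ⟨-, z, hz, hzy⟩ := hsub hy
      exact hyN z hz hzy
    refine (h.2.2 _ (hsep x hx) (.inr ⟨hmem, ?_⟩)).not_gt ((hordN x hx).trans_lt hlt)
    refine hP'.mem_of_le hs' (hsep x hx) ⟨Set.union_subset ?_ ?_, ?_⟩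
      (hle.trans_lt ((order_swap s).symm.trans_lt (hP'.order_lt _ hs')))
    · exact fun z hz => (hKs x hx hz).1
    · exact fun z hz => hz.1.2
    · exact fun z hz hzK => (hKs x hx hzK).2 hz
  have hunion : ∀ F : Finset V, (↑F ⊆ s.2 \ s.1) →
      (s.1 ∪ ⋃ x ∈ F, K x, s.2 \ ⋃ x ∈ F, K x) ∈ P := by
    intro F
    induction F using Finset.induction_on with
    | empty => intro _; simpa using hs
    | insert x F hxF ih =>
      intro hF
      rw [Finset.coe_insert, Set.insert_subset_iff] at hF
      have heq : CanonicalTD.join (s.1 ∪ ⋃ x ∈ F, K x, s.2 \ ⋃ x ∈ F, K x) (K x ∪ N x, (K x)ᶜ) =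
          (s.1 ∪ ⋃ z ∈ insert x F, K z, s.2 \ ⋃ z ∈ insert x F, K z) := by
        have hN : ∀ z, z ∈ N x → z ∈ s.1 := fun z hz => hz.1.1
        ext z <;>
        · have := hN z
          simp only [CanonicalTD.join, Set.mem_union, Set.mem_inter_iff, Set.mem_compl_iff,
            Set.mem_sdiff, Finset.set_biUnion_insert]
          tauto
      rw [← heq]
      refine hP.join_mem (ih hF.2) (hmem x hF.1) ?_
      rw [heq]
      refine lt_of_le_of_lt (Set.encard_le_encard ?_) (hP.order_lt s hs)
      rintro z ⟨hz | hz, hz2, hz'⟩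
      · exact ⟨hz, hz2⟩
      · exact absurd hz hz'
  -- Finitely many joins suffice: every component in `s.2 \ s.1` contains a neighbour of `Y`, and
  -- there are finitely many of those.
  have hFfin : {x ∈ s.2 \ s.1 | ∃ y ∈ Y, G.Adj y x}.Finite :=
    (hYfin.biUnion fun y _ => hlf y).subset fun x ⟨_, y, hy, hyx⟩ =>
      Set.mem_iUnion₂.2 ⟨y, hy, hyx⟩
  have hall := hunion hFfin.toFinset fun x hx => (hFfin.mem_toFinset.1 hx).1
  refine hP.not_subset hall fun d _ => ?_
  by_contra hd
  have hclosed : ∀ v ∈ (s.1 ∪ ⋃ x ∈ hFfin.toFinset, K x)ᶜ, ∀ w, G.Adj v w →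
      w ∈ (s.1 ∪ ⋃ x ∈ hFfin.toFinset, K x)ᶜ := by
    intro v hv w hvw
    have hv1 : v ∉ s.1 := fun h => hv (.inl h)
    have hv2 : v ∈ s.2 := (h.1.mem_or v).resolve_left hv1
    have hw2 : w ∈ s.2 := h.1.swap.mem_of_adj hvw hv1
    rintro (hw | hw)
    · refine hv (.inr (Set.mem_iUnion₂.2 ⟨v, ?_, Relation.ReflTransGen.refl⟩))
      exact hFfin.mem_toFinset.2 ⟨⟨hv2, hv1⟩, w, ⟨hw, hw2⟩, hvw.symm⟩
    · obtain ⟨x, hx, hxw⟩ := Set.mem_iUnion₂.1 hw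
      exact hv (.inr (Set.mem_iUnion₂.2 ⟨x, hx,
        Relation.ReflTransGen.tail hxw ⟨hvw.symm, fun h => hv1 h.1⟩⟩))
  rcases eq_empty_or_univ_of_adj_closed hG hclosed with hZ | hZ
  · exact hZ.subset (show d ∈ (s.1 ∪ ⋃ x ∈ hFfin.toFinset, K x)ᶜ from hd)
  · refine hP'.not_subset hs' fun v hv => ?_
    have : v ∈ (s.1 ∪ ⋃ x ∈ hFfin.toFinset, K x)ᶜ := hZ ▸ Set.mem_univ v
    exact absurd (.inl hv) this

theorem isTight {ℓ ℓ' : ℕ∞} (hG : G.Connected) (hlf : IsLocallyFinite G)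
    (hP : IsProfileOfOrder G ℓ P) (hP' : IsProfileOfOrder G ℓ' P')
    (h : DistinguishesEfficiently G s P P') : IsTight G s := by
  wlog hs : s ∈ P ∧ s.swap ∈ P' generalizing P P' ℓ ℓ'
  · exact this hP' hP h.symm (h.mem_cases.resolve_left hs)
  obtain ⟨v, hv, hvN⟩ := h.exists_full_component hG hlf hP hP' hs.1 hs.2
  obtain ⟨u, hu, huN⟩ := h.symm.swap.exists_full_component hG hlf hP' hP hs.2 hs.1
  rw [Prod.fst_swap, Prod.snd_swap, Set.inter_comm] at huN
  exact ⟨h.1, u, hu, v, hv, fun h => hu.2 h.2, fun h => hv.2 h.1, huN, hvN,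
    fun hr => (hr.mem_diff h.1 hu).2 hv.1⟩

end DistinguishesEfficiently

/-! ### Corners of efficient distinguishers -/

/-- `c` is a corner of `a` and `b`, up to orientation. -/
def IsCorner (c a b : Set V × Set V) : Prop :=
  ∃ s t, (s = a ∨ s = a.swap) ∧ (t = b ∨ t = b.swap) ∧ c = join s t

theorem IsCorner.nested_right {a b c : Set V × Set V} (h : IsCorner c a b) : Nested c b := by
  obtain ⟨s, t, -, rfl | rfl, rfl⟩ := h
  · exact (nested_join_right _ _).symm
  · rw [← nested_swap_right]; exact (nested_join_right _ _).symm

theorem IsCorner.nested {a b c d : Set V × Set V} (h : IsCorner c a b) (hab : ¬ Nested a b)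
    (ha : Nested d a) (hb : Nested d b) : Nested d c := by
  obtain ⟨s, t, rfl | rfl, rfl | rfl, rfl⟩ := h <;> refine Nested.join ?_ ?_ ?_ <;> simpa

/-- Submodularity in the form used below; finiteness of `order t` permits cancellation in `ℕ∞`. -/
theorem order_join_swap_lt {s t : Set V × Set V} (ht : order t ≠ ⊤)
    (h : order s < order (join s t)) : order (join s.swap t.swap) < order t := by
  have hsub := order_join_add_order_join_swap_le s t
  by_contra! hle
  exact (ENat.add_lt_add_of_lt_of_le ht h hle).not_ge hsub

/-- By efficiency of `a`, both `Q` and `Q'` orient `b` the same way, say as `b`. If `join a b` or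
`join a.swap b` has order at most that of `a`, it still distinguishes `Q` from `Q'`. Otherwise both
opposite corners have order below that of `b`. Then `P` and `P'` orient them alike, and having both
in the profile that contains `b.swap` contradicts its robustness. -/
theorem exists_corner_of_order_lt {P P' Q Q' : Set (Set V × Set V)} {ℓP ℓP' ℓQ ℓQ' : ℕ∞}
    (hP : IsProfileOfOrder G ℓP P) (hP' : IsProfileOfOrder G ℓP' P')
    (hQ : IsProfileOfOrder G ℓQ Q) (hQ' : IsProfileOfOrder G ℓQ' Q')
    (hrP : IsRobust G P) (hrP' : IsRobust G P') {a b : Set V × Set V}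
    (ha : DistinguishesEfficiently G a Q Q') (hb : DistinguishesEfficiently G b P P')
    (hab : order b < order a) : ∃ c, IsCorner c a b ∧ DistinguishesEfficiently G c Q Q' := by
  wlog haQ : a ∈ Q ∧ a.swap ∈ Q' generalizing Q Q' ℓQ ℓQ'
  · obtain ⟨c, hc, hc'⟩ := this hQ' hQ ha.symm (ha.mem_cases.resolve_left haQ)
    exact ⟨c, hc, hc'.symm⟩
  have haQ'ord : order b ≤ order a.swap := by simpa using hab.le
  wlog hbQ : b ∈ Q generalizing b
  · have hbQ := (hQ.mem_or_swap_mem_of_order_le haQ.1 hb.1 hab.le).resolve_left hbQ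
    obtain ⟨c, ⟨s, t, hs, ht, rfl⟩, hc'⟩ := this hb.swap (by simpa) (by simpa using hab.le) hbQ
    exact ⟨_, ⟨s, t, hs, by rw [or_comm]; simpa using ht, rfl⟩, hc'⟩
  have hbQ' : b ∈ Q' := by
    refine (hQ'.mem_or_swap_mem_of_order_le haQ.2 hb.1 haQ'ord).resolve_right fun h => ?_
    exact (ha.2.2 b hb.1 (.inl ⟨hbQ, h⟩)).not_gt hab
  wlog hbP : b ∈ P ∧ b.swap ∈ P' generalizing P P' ℓP ℓP'
  · exact this hP' hP hrP' hrP hb.symm (hb.mem_cases.resolve_left hbP)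
  by_contra! hcon
  have hatop : order a ≠ ⊤ := ((hQ.order_lt a haQ.1).trans_le le_top).ne
  have hbtop : order b ≠ ⊤ := (hab.trans_le le_top).ne
  have h1 : order a < order (join a b) := not_le.1 fun hle =>
    hcon _ ⟨a, b, .inl rfl, .inl rfl, rfl⟩ (ha.join hQ hQ' haQ.1 haQ.2 hbQ hle)
  have h2 : order a.swap < order (join a.swap b) := not_le.1 fun hle =>
    hcon _ ⟨a.swap, b, .inr rfl, .inl rfl, rfl⟩
      (ha.swap.symm.join hQ' hQ haQ.2 haQ.1 hbQ' hle).symm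
  have h3 := order_join_swap_lt hbtop h1
  have h4 := order_join_swap_lt hbtop h2
  rw [Prod.swap_swap] at h4
  have hmem : ∀ r, IsSeparation G r → order (join r b.swap) < order b →
      (join r b.swap).swap ∈ P' := by
    intro r hr hlt
    have hsep := (hr.join hb.1.swap).swap
    have hlt' : order (join r b.swap).swap < order b := by rwa [order_swap]
    have hmemP : (join r b.swap).swap ∈ P :=
      hP.mem_of_le hbP.1 hsep (le_join_right r b.swap).swap (hlt'.trans (hP.order_lt b hbP.1))
    refine (hP'.mem_or_swap_mem_of_order_le hbP.2 hsep (by simpa using hlt.le)).resolve_right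
      fun hmemP' => ?_
    exact (hb.2.2 _ hsep (.inl ⟨hmemP, hmemP'⟩)).not_gt hlt'
  obtain ⟨n, hn⟩ := ENat.ne_top_iff_exists.1 hatop
  have e1 : (b.swap.2 ∩ a.1, b.swap.1 ∪ a.2) = (join a.swap b.swap).swap :=
    Prod.ext (Set.inter_comm _ _) (Set.union_comm _ _)
  have e2 : (b.swap.2 ∩ a.2, b.swap.1 ∪ a.1) = (join a b.swap).swap :=
    Prod.ext (Set.inter_comm _ _) (Set.union_comm _ _)
  refine hrP' n b.swap hbP.2 a ha.1 hn.ge ?_ ?_ ⟨?_, ?_⟩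
  · rw [e1]; simpa using h3
  · rw [e2]; simpa using h4
  · rw [e1]; exact hmem _ ha.1.swap h3
  · rw [e2]; exact hmem _ ha.1 h4

/-- All four profiles orient both separations, and these orientations determine which corners
inherit the property of distinguishing `P, P'` or `Q, Q'`, provided their order is small enough.
Submodularity of the order gives that proviso for opposite corners together; `hcr` then makes one of
them cross less. -/
theorem exists_corner_of_order_eq {P P' Q Q' : Set (Set V × Set V)} {ℓP ℓP' ℓQ ℓQ' : ℕ∞}
    (hP : IsProfileOfOrder G ℓP P) (hP' : IsProfileOfOrder G ℓP' P')
    (hQ : IsProfileOfOrder G ℓQ Q) (hQ' : IsProfileOfOrder G ℓQ' Q') {a b : Set V × Set V}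
    (ha : DistinguishesEfficiently G a P P') (hb : DistinguishesEfficiently G b Q Q')
    (hab : order a = order b) (cr : Set V × Set V → ℕ)
    (hcr : ∀ s t, (s = a ∨ s = a.swap) → (t = b ∨ t = b.swap) →
      cr (join s t) + cr (join s.swap t.swap) < cr a + cr b) :
    ∃ c, IsCorner c a b ∧ (DistinguishesEfficiently G c P P' ∧ cr c < cr a ∨
      DistinguishesEfficiently G c Q Q' ∧ cr c < cr b) := by
  wlog haP : a ∈ P ∧ a.swap ∈ P' generalizing P P' ℓP ℓP'
  · obtain ⟨c, hc, hc'⟩ := this hP' hP ha.symm (ha.mem_cases.resolve_left haP)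
    exact ⟨c, hc, hc'.imp_left fun h => ⟨h.1.symm, h.2⟩⟩
  wlog hbQ : b ∈ Q ∧ b.swap ∈ Q' generalizing Q Q' ℓQ ℓQ'
  · obtain ⟨c, hc, hc'⟩ := this hQ' hQ hb.symm (hb.mem_cases.resolve_left hbQ)
    exact ⟨c, hc, hc'.imp_right fun h => ⟨h.1.symm, h.2⟩⟩
  have hatop : order a ≠ ⊤ := ((hP.order_lt a haP.1).trans_le le_top).ne
  have hor {s : Set V × Set V} {x : Set V × Set V} (h : s = x ∨ s = x.swap) :
      s.swap = x ∨ s.swap = x.swap := by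
    rcases h with rfl | rfl <;> simp
  have hord {s : Set V × Set V} {x : Set V × Set V} (h : s = x ∨ s = x.swap) :
      order s = order x := by
    rcases h with rfl | rfl <;> simp
  -- If one of two opposite corners had too large an order, the other would have order below that of
  -- `a`, which is impossible for an efficient distinguisher.
  have both : ∀ A B : Set V × Set V → Prop, (∀ c, A c → order c = order a) →
      (∀ c, B c → order c = order a) → ∀ s t, (s = a ∨ s = a.swap) → (t = b ∨ t = b.swap) →
      (order (join s t) ≤ order a → A (join s t)) →
      (order (join s.swap t.swap) ≤ order a → B (join s.swap t.swap)) →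
      A (join s t) ∧ B (join s.swap t.swap) := by
    intro A B hA hB s t hs ht hA' hB'
    have hs' := hord hs
    have ht' := (hord ht).trans hab.symm
    by_cases h1 : order (join s t) ≤ order a
    · refine ⟨hA' h1, hB' ?_⟩
      by_contra! hlt
      have hlt' : order s.swap < order (join s.swap t.swap) := by rwa [order_swap, hs']
      have := order_join_swap_lt (by rwa [order_swap, ht']) hlt'
      rw [Prod.swap_swap, Prod.swap_swap, order_swap, ht', hA _ (hA' h1)] at this
      exact this.false
    · rw [not_le, ← hs'] at h1
      have := order_join_swap_lt (by rwa [ht']) h1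
      rw [ht'] at this
      rw [hB _ (hB' this.le)] at this
      exact absurd this (lt_irrefl _)
  have hE : ∀ c, DistinguishesEfficiently G c P P' → order c = order a := fun c h => h.order_eq ha
  have hF : ∀ c, DistinguishesEfficiently G c Q Q' → order c = order a :=
    fun c h => (h.order_eq hb).trans hab.symm
  have mixed : ∀ s t, (s = a ∨ s = a.swap) → (t = b ∨ t = b.swap) →
      (order (join s t) ≤ order a → DistinguishesEfficiently G (join s t) P P') →
      (order (join s.swap t.swap) ≤ order a →
        DistinguishesEfficiently G (join s.swap t.swap) Q Q') →
      ∃ c, IsCorner c a b ∧ (DistinguishesEfficiently G c P P' ∧ cr c < cr a ∨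
        DistinguishesEfficiently G c Q Q' ∧ cr c < cr b) := by
    intro s t hs ht h1 h2
    obtain ⟨h1, h2⟩ := both _ _ hE hF s t hs ht h1 h2
    have := hcr s t hs ht
    by_cases hlt : cr (join s t) < cr a
    · exact ⟨_, ⟨s, t, hs, ht, rfl⟩, .inl ⟨h1, hlt⟩⟩
    · exact ⟨_, ⟨_, _, hor hs, hor ht, rfl⟩, .inr ⟨h2, by omega⟩⟩
  have hP1 : ∀ t, t ∈ P → order (join a t) ≤ order a →
      DistinguishesEfficiently G (join a t) P P' := fun t ht => ha.join hP hP' haP.1 haP.2 ht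
  have hP2 : ∀ t, t ∈ P' → order (join a.swap t) ≤ order a →
      DistinguishesEfficiently G (join a.swap t) P P' := fun t ht hle =>
    (ha.swap.symm.join hP' hP haP.2 haP.1 ht (by simpa using hle)).symm
  have hQ1 : ∀ s, s ∈ Q → order (join s b) ≤ order a →
      DistinguishesEfficiently G (join s b) Q Q' := fun s hs hle => by
    rw [join_comm] at hle ⊢
    exact hb.join hQ hQ' hbQ.1 hbQ.2 hs (hle.trans_eq hab)
  have hQ2 : ∀ s, s ∈ Q' → order (join s b.swap) ≤ order a →
      DistinguishesEfficiently G (join s b.swap) Q Q' := fun s hs hle => by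
    rw [join_comm] at hle ⊢
    exact (hb.swap.symm.join hQ' hQ hbQ.2 hbQ.1 hs (by simpa [← hab] using hle)).symm
  have obP := hP.mem_or_swap_mem_of_order_le haP.1 hb.1 hab.ge
  have obP' := hP'.mem_or_swap_mem_of_order_le haP.2 hb.1 (by simpa using hab.ge)
  have oaQ := hQ.mem_or_swap_mem_of_order_le hbQ.1 ha.1 hab.le
  have oaQ' := hQ'.mem_or_swap_mem_of_order_le hbQ.2 ha.1 (by simpa using hab.le)
  -- Needed only if `b` also distinguishes `P, P'` and `a` also distinguishes `Q, Q'`. Adding the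
  -- inequalities `hcr` for the two pairs of opposite corners shows that one of the four corners
  -- improves on the separation it replaces.
  have opposite : ∀ s t s' t', (s = a ∨ s = a.swap) → (t = b ∨ t = b.swap) →
      (s' = a ∨ s' = a.swap) → (t' = b ∨ t' = b.swap) →
      (order (join s t) ≤ order a → DistinguishesEfficiently G (join s t) P P') →
      (order (join s.swap t.swap) ≤ order a →
        DistinguishesEfficiently G (join s.swap t.swap) P P') →
      (order (join s' t') ≤ order a → DistinguishesEfficiently G (join s' t') Q Q') →
      (order (join s'.swap t'.swap) ≤ order a →
        DistinguishesEfficiently G (join s'.swap t'.swap) Q Q') →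
      ∃ c, IsCorner c a b ∧ (DistinguishesEfficiently G c P P' ∧ cr c < cr a ∨
        DistinguishesEfficiently G c Q Q' ∧ cr c < cr b) := by
    intro s t s' t' hs ht hs' ht' h1 h2 h3 h4
    obtain ⟨h1, h2⟩ := both _ _ hE hE s t hs ht h1 h2
    obtain ⟨h3, h4⟩ := both _ _ hF hF s' t' hs' ht' h3 h4
    have e1 := hcr s t hs ht
    have e2 := hcr s' t' hs' ht'
    by_cases c1 : cr (join s t) < cr a
    · exact ⟨_, ⟨s, t, hs, ht, rfl⟩, .inl ⟨h1, c1⟩⟩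
    by_cases c2 : cr (join s.swap t.swap) < cr a
    · exact ⟨_, ⟨_, _, hor hs, hor ht, rfl⟩, .inl ⟨h2, c2⟩⟩
    by_cases c3 : cr (join s' t') < cr b
    · exact ⟨_, ⟨s', t', hs', ht', rfl⟩, .inr ⟨h3, c3⟩⟩
    · exact ⟨_, ⟨_, _, hor hs', hor ht', rfl⟩, .inr ⟨h4, by omega⟩⟩
  rcases obP with hbP | hbP <;> rcases obP' with hbP' | hbP'
  · rcases oaQ' with haQ' | haQ'
    · exact mixed a.swap b (.inr rfl) (.inl rfl) (hP2 b hbP') (by simpa using hQ2 a haQ')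
    · exact mixed a b (.inl rfl) (.inl rfl) (hP1 b hbP) (hQ2 _ haQ')
  · rcases oaQ with haQ | haQ
    · exact mixed a.swap b.swap (.inr rfl) (.inr rfl) (hP2 _ hbP') (by simpa using hQ1 a haQ)
    · rcases oaQ' with haQ' | haQ'
      · exact opposite a b a.swap b (.inl rfl) (.inl rfl) (.inr rfl) (.inl rfl) (hP1 b hbP)
          (hP2 _ hbP') (hQ1 _ haQ) (by simpa using hQ2 a haQ')
      · exact mixed a b (.inl rfl) (.inl rfl) (hP1 b hbP) (hQ2 _ haQ')
  · rcases oaQ with haQ | haQ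
    · rcases oaQ' with haQ' | haQ'
      · exact mixed a.swap b (.inr rfl) (.inl rfl) (hP2 b hbP') (by simpa using hQ2 a haQ')
      · exact opposite a b.swap a b (.inl rfl) (.inr rfl) (.inl rfl) (.inl rfl) (hP1 _ hbP)
          (by simpa using hP2 _ hbP') (hQ1 _ haQ) (hQ2 _ haQ')
    · exact mixed a b.swap (.inl rfl) (.inr rfl) (hP1 _ hbP) (by simpa using hQ1 _ haQ)
  · rcases oaQ with haQ | haQ
    · exact mixed a.swap b.swap (.inr rfl) (.inr rfl) (hP2 _ hbP') (by simpa using hQ1 a haQ)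
    · exact mixed a b.swap (.inl rfl) (.inr rfl) (hP1 _ hbP) (by simpa using hQ1 _ haQ)

@[simp] theorem crossing_swap (U : Set (Set V × Set V)) (s : Set V × Set V) :
    crossing Nested U s.swap = crossing Nested U s := by
  simp [crossing]

/-- Opposite corners of crossing separations together cross fewer separations. -/
theorem ncard_crossing_join_add_lt {U : Set (Set V × Set V)} {s t : Set V × Set V}
    (hst : ¬ Nested s t) (hsU : s ∈ U) (hs : (crossing Nested U s).Finite)
    (ht : (crossing Nested U t).Finite) :
    (crossing Nested U (join s t)).ncard + (crossing Nested U (join s.swap t.swap)).ncard <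
      (crossing Nested U s).ncard + (crossing Nested U t).ncard := by
  have hst' : ¬ Nested s.swap t.swap := by simpa
  have key : ∀ d, (Nested s d → Nested t d → Nested (join s t) d ∧ Nested (join s.swap t.swap) d) ∧
      (Nested s d ∨ Nested t d → Nested (join s t) d ∨ Nested (join s.swap t.swap) d) := by
    intro d
    simp only [nested_comm (t := d)]
    refine ⟨fun h1 h2 => ⟨h1.join hst h2, Nested.join hst' (by simpa) (by simpa)⟩, ?_⟩
    rintro (h | h)
    · exact h.join_or_join_swap t
    · rw [join_comm s, join_comm s.swap]
      exact h.join_or_join_swap s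
  have hunion : crossing Nested U (join s t) ∪ crossing Nested U (join s.swap t.swap) ⊂
      crossing Nested U s ∪ crossing Nested U t := by
    refine ⟨?_, fun hsub => ?_⟩
    · rintro d (⟨hd, h⟩ | ⟨hd, h⟩) <;>
      · by_contra hcon
        simp only [Set.mem_union, crossing, Set.mem_ofPred_eq, hd, true_and, not_or, not_not] at hcon
        have := (key d).1 hcon.1 hcon.2
        tauto
    -- Strictness comes from `s` itself, which crosses `t` but neither corner.
    · rcases hsub (a := s) (.inr ⟨hsU, fun h => hst h.symm⟩) with h | h
      · exact h.2 (nested_join_left s t).symm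
      · exact h.2 (nested_swap_right.1 (nested_join_left s.swap t.swap).symm)
  have hinter : crossing Nested U (join s t) ∩ crossing Nested U (join s.swap t.swap) ⊆
      crossing Nested U s ∩ crossing Nested U t := by
    rintro d ⟨⟨hd, h1⟩, -, h2⟩
    have := (key d).2
    exact ⟨⟨hd, by tauto⟩, hd, by tauto⟩
  have hfin := (hs.union ht).subset hunion.1
  rw [← Set.ncard_union_add_ncard_inter _ _ (hfin.subset Set.subset_union_left)
    (hfin.subset Set.subset_union_right), ← Set.ncard_union_add_ncard_inter _ _ hs ht]
  exact add_lt_add_of_lt_of_le (Set.ncard_lt_ncard hunion (hs.union ht))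
    (Set.ncard_le_ncard hinter (hs.inter_of_left _))

/-! ### The canonical nested set of efficient distinguishers -/

/-- The sets of efficient distinguishers of order `n` of pairs of profiles in `𝓟`. -/
def distinguisherFamily (G : SimpleGraph V) (𝓟 : Set (Set (Set V × Set V))) (n : ℕ) :
    Set (Set (Set V × Set V)) :=
  {X | ∃ P ∈ 𝓟, ∃ P' ∈ 𝓟, P ≠ P' ∧ X = {s | DistinguishesEfficiently G s P P'} ∧
    ∃ s ∈ X, order s = n}

/-- A canonical nested set of separations that distinguishes the profiles in `𝓟` efficiently. -/
def canonicalSet (G : SimpleGraph V) (𝓟 : Set (Set (Set V × Set V))) : Set (Set V × Set V) :=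
  ⋃ n, splinterLevel Nested (distinguisherFamily G 𝓟) n

section

variable {k : ℕ} {𝓟 : Set (Set (Set V × Set V))}

theorem mem_sUnion_distinguisherFamily {n : ℕ} {s : Set V × Set V} :
    s ∈ ⋃₀ distinguisherFamily G 𝓟 n ↔
      (∃ P ∈ 𝓟, ∃ P' ∈ 𝓟, P ≠ P' ∧ DistinguishesEfficiently G s P P') ∧ order s = n := by
  constructor
  · rintro ⟨_, ⟨P, hP, P', hP', hne, rfl, t, ht, htn⟩, hs⟩
    exact ⟨⟨P, hP, P', hP', hne, hs⟩, (hs.order_eq ht).trans htn⟩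
  · rintro ⟨⟨P, hP, P', hP', hne, hs⟩, hn⟩
    exact ⟨_, ⟨P, hP, P', hP', hne, rfl, s, hs, hn⟩, hs⟩

theorem IsAdmissible.isTight (h : IsAdmissible k G 𝓟) {n : ℕ} {s : Set V × Set V}
    (hs : s ∈ ⋃₀ distinguisherFamily G 𝓟 n) : IsTight G s ∧ order s = n ∧ order s ≤ k := by
  obtain ⟨⟨P, hP, P', hP', hne, hs⟩, hn⟩ := mem_sUnion_distinguisherFamily.1 hs
  obtain ⟨ℓ, hℓ⟩ := h.isProfile P hP
  obtain ⟨ℓ', hℓ'⟩ := h.isProfile P' hP'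
  obtain ⟨t, ht, htk, htd⟩ := h.distinguishable hP hP' hne
  exact ⟨hs.isTight h.connected h.locallyFinite hℓ hℓ', hn, (hs.2.2 t ht htd).trans htk⟩

theorem IsAdmissible.finite_crossing (h : IsAdmissible k G 𝓟) {n : ℕ} {s : Set V × Set V}
    (hs : s ∈ ⋃₀ distinguisherFamily G 𝓟 n) (m : ℕ) :
    (crossing Nested (⋃₀ distinguisherFamily G 𝓟 m) s).Finite := by
  obtain ⟨hst, hsn, -⟩ := h.isTight hs
  refine (finite_isTight_crossing h.connected h.locallyFinite m hst.1
    (Set.finite_of_encard_eq_coe hsn)).subset ?_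
  rintro t ⟨ht, hst⟩
  obtain ⟨htt, htm, -⟩ := h.isTight ht
  exact ⟨htt, htm.le, hst⟩

theorem IsAdmissible.splintersThinly (h : IsAdmissible k G 𝓟) :
    SplintersThinly Nested (distinguisherFamily G 𝓟) where
  symm _ _ := Nested.symm
  nonempty := by
    rintro n X ⟨P, hP, P', hP', hne, rfl, s, hs, -⟩
    exact ⟨s, hs⟩
  finite_crossing _ _ ha m := h.finite_crossing ha m
  of_lt := by
    rintro m n hmn _ ⟨Q, hQ, Q', hQ', hne, rfl, s, hs, hsn⟩ a ha b hb hab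
    obtain ⟨⟨P, hP, P', hP', hne', hb⟩, hbm⟩ := mem_sUnion_distinguisherFamily.1 hb
    obtain ⟨ℓP, hℓP⟩ := h.isProfile P hP
    obtain ⟨ℓP', hℓP'⟩ := h.isProfile P' hP'
    obtain ⟨ℓQ, hℓQ⟩ := h.isProfile Q hQ
    obtain ⟨ℓQ', hℓQ'⟩ := h.isProfile Q' hQ'
    have hord : order b < order a := by
      rw [hbm, DistinguishesEfficiently.order_eq ha hs, hsn]
      exact_mod_cast hmn
    obtain ⟨c, hc, hcd⟩ := exists_corner_of_order_lt hℓP hℓP' hℓQ hℓQ' (h.robust P hP)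
      (h.robust P' hP') ha hb hord
    exact ⟨c, hcd, hc.nested_right, fun d => hc.nested hab⟩
  of_eq := by
    intro n X hX Y hY a haX b hbY hab
    have haU : a ∈ ⋃₀ distinguisherFamily G 𝓟 n := ⟨X, hX, haX⟩
    have hbU : b ∈ ⋃₀ distinguisherFamily G 𝓟 n := ⟨Y, hY, hbY⟩
    obtain ⟨P, hP, P', hP', hne, rfl, -⟩ := hX
    obtain ⟨Q, hQ, Q', hQ', hne', rfl, -⟩ := hY
    obtain ⟨ℓP, hℓP⟩ := h.isProfile P hP
    obtain ⟨ℓP', hℓP'⟩ := h.isProfile P' hP'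
    obtain ⟨ℓQ, hℓQ⟩ := h.isProfile Q hQ
    obtain ⟨ℓQ', hℓQ'⟩ := h.isProfile Q' hQ'
    have hswap : a.swap ∈ ⋃₀ distinguisherFamily G 𝓟 n := by
      have := mem_sUnion_distinguisherFamily.1 haU
      refine mem_sUnion_distinguisherFamily.2 ⟨⟨P, hP, P', hP', hne, ?_⟩, by simpa using this.2⟩
      exact DistinguishesEfficiently.swap haX
    have hord : order a = order b := by
      rw [(mem_sUnion_distinguisherFamily.1 haU).2, (mem_sUnion_distinguisherFamily.1 hbU).2]
    obtain ⟨c, hc, hc'⟩ := exists_corner_of_order_eq hℓP hℓP' hℓQ hℓQ' haX hbY hord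
      (fun s => (crossing Nested (⋃₀ distinguisherFamily G 𝓟 n) s).ncard) (by
        rintro s t hs ht
        have hsU : s ∈ ⋃₀ distinguisherFamily G 𝓟 n := by
          rcases hs with rfl | rfl <;> assumption
        have ht' : crossing Nested (⋃₀ distinguisherFamily G 𝓟 n) t =
            crossing Nested (⋃₀ distinguisherFamily G 𝓟 n) b := by
          rcases ht with rfl | rfl <;> simp
        have hs' : crossing Nested (⋃₀ distinguisherFamily G 𝓟 n) s =
            crossing Nested (⋃₀ distinguisherFamily G 𝓟 n) a := by
          rcases hs with rfl | rfl <;> simp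
        rw [← hs', ← ht']
        refine ncard_crossing_join_add_lt ?_ hsU (h.finite_crossing hsU n)
          (ht' ▸ h.finite_crossing hbU n)
        rcases hs with rfl | rfl <;> rcases ht with rfl | rfl <;> simpa)
    exact ⟨c, fun d => hc.nested hab, hc'⟩

/-- Reversing orientation preserves nestedness and maps every member of the family onto itself. -/
theorem swap_mem_canonicalSet {s : Set V × Set V} (hs : s ∈ canonicalSet G 𝓟) :
    s.swap ∈ canonicalSet G 𝓟 := by
  have hinv : ∀ n, distinguisherFamily G 𝓟 n =
      Set.image (Equiv.prodComm (Set V) (Set V)) '' distinguisherFamily G 𝓟 n := by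
    intro n
    have himg : ∀ X ∈ distinguisherFamily G 𝓟 n, Equiv.prodComm (Set V) (Set V) '' X = X := by
      rintro _ ⟨P, -, P', -, -, rfl, -⟩
      ext s
      constructor
      · rintro ⟨t, ht, rfl⟩
        exact DistinguishesEfficiently.swap ht
      · exact fun h => ⟨s.swap, DistinguishesEfficiently.swap h, s.swap_swap⟩
    ext X
    exact ⟨fun hX => ⟨X, hX, himg X hX⟩, fun ⟨Y, hY, h⟩ => h ▸ (himg Y hY).symm ▸ hY⟩
  obtain ⟨n, hn⟩ := Set.mem_iUnion.1 hs
  refine Set.mem_iUnion.2 ⟨n, ?_⟩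
  rw [splinterLevel_image (Equiv.prodComm (Set V) (Set V)) (R := Nested) (R' := Nested)
    (fun a b => by simp) hinv]
  exact ⟨s, hn, rfl⟩

theorem IsAdmissible.nested_canonicalSet (h : IsAdmissible k G 𝓟) {s t : Set V × Set V}
    (hs : s ∈ canonicalSet G 𝓟) (ht : t ∈ canonicalSet G 𝓟) : Nested s t := by
  obtain ⟨m, hm⟩ := Set.mem_iUnion.1 hs
  obtain ⟨n, hn⟩ := Set.mem_iUnion.1 ht
  exact h.splintersThinly.nested hm hn

theorem IsAdmissible.isTight_of_mem_canonicalSet (h : IsAdmissible k G 𝓟) {s : Set V × Set V}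
    (hs : s ∈ canonicalSet G 𝓟) : IsTight G s ∧ order s ≤ k := by
  obtain ⟨m, hm⟩ := Set.mem_iUnion.1 hs
  have := h.isTight (splinterLevel_subset hm)
  exact ⟨this.1, this.2.2⟩

theorem IsAdmissible.exists_mem_canonicalSet (h : IsAdmissible k G 𝓟) {P P' : Set (Set V × Set V)}
    (hP : P ∈ 𝓟) (hP' : P' ∈ 𝓟) (hne : P ≠ P') :
    ∃ s ∈ canonicalSet G 𝓟, DistinguishesEfficiently G s P P' := by
  obtain ⟨s, ⟨hs, hsd⟩, hmin⟩ := exists_minimalFor_of_wellFoundedLT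
    (fun s => IsSeparation G s ∧ Distinguishes s P P') order
    (by obtain ⟨t, ht, -, htd⟩ := h.distinguishable hP hP' hne; exact ⟨t, ht, htd⟩)
  have heff : DistinguishesEfficiently G s P P' := ⟨hs, hsd, fun t ht htd =>
    (le_total _ _).elim id fun hle => hmin ⟨ht, htd⟩ hle⟩
  have hsk : order s ≤ k := by
    obtain ⟨t, ht, htk, htd⟩ := h.distinguishable hP hP' hne
    exact (heff.2.2 t ht htd).trans htk
  obtain ⟨n, hn⟩ := ENat.ne_top_iff_exists.1 (hsk.trans_lt (ENat.natCast_lt_top k)).ne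
  obtain ⟨a, ha, ha'⟩ := h.splintersThinly.exists_mem (n := n)
    (X := {s | DistinguishesEfficiently G s P P'}) ⟨P, hP, P', hP', hne, rfl, s, heff, hn.symm⟩
  exact ⟨a, Set.mem_iUnion.2 ⟨n, ha'⟩, ha⟩

end

/-! ### From nested sets of separations to tree-decompositions -/

/-- A nested symmetric set of separations, none of them with one side included in the other, only
finitely many of which separate any two given vertices. -/
structure IsTreeSet (G : SimpleGraph V) (N : Set (Set V × Set V)) : Prop where
  isSeparation : ∀ s ∈ N, IsSeparation G s
  swap_mem : ∀ s ∈ N, s.swap ∈ N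
  nested : ∀ s ∈ N, ∀ t ∈ N, Nested s t
  not_subset : ∀ s ∈ N, ¬ s.1 ⊆ s.2
  finite_separating : ∀ v w, {s ∈ N | v ∈ s.1 ∧ w ∈ s.2}.Finite

/-- The orientation of `N` towards the node in which the edge `s` ends. -/
def head (N : Set (Set V × Set V)) (s : Set V × Set V) : Set (Set V × Set V) :=
  {r ∈ N | SepLE r s ∨ SepLE s r.swap ∧ s ≠ r.swap}

/-- The nodes of the tree of a nested set of separations. -/
def nodes (N : Set (Set V × Set V)) : Set (Set (Set V × Set V)) :=
  {O | N = ∅ ∧ O = ∅ ∨ ∃ s ∈ N, head N s = O}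

theorem subset_of_mem_nodes {N O : Set (Set V × Set V)} (hO : O ∈ nodes N) : O ⊆ N := by
  rcases hO with ⟨-, rfl⟩ | ⟨s, -, rfl⟩
  · exact Set.empty_subset N
  · exact fun r hr => hr.1

namespace IsTreeSet

variable {N : Set (Set V × Set V)} {r s t : Set V × Set V}

theorem exists_mem_fst (h : IsTreeSet G N) (hs : s ∈ N) : ∃ v, v ∈ s.1 := by
  obtain ⟨v, hv, -⟩ := Set.not_subset.1 (h.not_subset s hs)
  exact ⟨v, hv⟩

/-- Otherwise `s ≤ t ≤ s.swap`, whence `s.1 ⊆ s.2`. -/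
theorem not_le_swap (h : IsTreeSet G N) (hs : s ∈ N) (ht : SepLE s t) : ¬ SepLE s t.swap :=
  fun ht' => h.not_subset s hs (ht.trans ht'.swap).1

theorem not_swap_le (h : IsTreeSet G N) (hs : s ∈ N) (ht : SepLE t s) : ¬ SepLE t.swap s :=
  fun ht' => h.not_subset _ (h.swap_mem s hs) (ht'.swap.trans ht).1

/-- Everything between `s` and `t` separates a fixed vertex of `s.1` from a fixed vertex of `t.2`.
-/
theorem finite_interval (h : IsTreeSet G N) (hs : s ∈ N) (ht : t ∈ N) :
    {r ∈ N | SepLE s r ∧ SepLE r t}.Finite := by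
  obtain ⟨v, hv⟩ := h.exists_mem_fst hs
  obtain ⟨w, hw⟩ := h.exists_mem_fst (h.swap_mem t ht)
  exact (h.finite_separating v w).subset fun r hr => ⟨hr.1, hr.2.1.1 hv, hr.2.2.2 hw⟩

theorem mem_head_self (hs : s ∈ N) : s ∈ head N s := ⟨hs, .inl (SepLE.refl s)⟩

theorem notMem_head_swap (h : IsTreeSet G N) (hs : s ∈ N) : s ∉ head N s.swap := by
  rintro ⟨-, h' | h'⟩
  · exact h.not_le_swap hs (SepLE.refl s) h'
  · exact h'.2 rfl

/-- The two ends of an edge orient every other edge alike. -/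
theorem mem_head_swap_of_mem_head (hr : r ∈ head N t) (h1 : r ≠ t) : r ∈ head N t.swap := by
  obtain ⟨hrN, hr | hr⟩ := hr
  · exact ⟨hrN, .inr ⟨hr.swap, fun heq => h1 (Prod.swap_injective heq.symm)⟩⟩
  · exact ⟨hrN, .inl hr.1.swap⟩

theorem mem_head_iff_mem_head_swap (h1 : r ≠ t) (h2 : r ≠ t.swap) :
    r ∈ head N t ↔ r ∈ head N t.swap :=
  ⟨fun h => mem_head_swap_of_mem_head h h1, fun h => by
    simpa using mem_head_swap_of_mem_head h h2⟩

/-- Consecutive edges meet in a node. -/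
theorem head_eq_of_covers (h : IsTreeSet G N) (hs : s ∈ N) (ht : t ∈ N) (hst : SepLE s t)
    (hne : s ≠ t) (hcov : ∀ r ∈ N, SepLE s r → SepLE r t → r = s ∨ r = t) :
    head N s = head N t.swap := by
  ext r
  refine and_congr_right fun hr => ⟨?_, ?_⟩
  · rintro (hrs | ⟨hsr, hsr'⟩)
    · refine .inr ⟨(hrs.trans hst).swap, fun heq => hne ?_⟩
      rw [← Prod.swap_injective heq] at hrs
      exact hst.antisymm hrs
    · rcases h.nested r hr t ht with hrt | hrt | hrt | hrt
      · refine .inr ⟨hrt.swap, fun heq => ?_⟩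
        rw [← heq] at hsr
        exact h.not_le_swap hs hst hsr
      · exact .inl hrt
      · rcases hcov _ (h.swap_mem r hr) hsr hrt with heq | heq
        · exact absurd heq.symm hsr'
        · rw [← heq, Prod.swap_swap]
          exact .inl (SepLE.refl r)
      · exact absurd hsr (h.not_le_swap hs (hst.trans hrt.swap))
  · rintro (hrt | ⟨hrt, hrt'⟩)
    · refine .inr ⟨hst.trans hrt.swap, fun heq => hne ?_⟩
      have := hrt.swap
      rw [← heq] at this
      exact hst.antisymm this
    · have hrt := sepLE_swap_iff.1 hrt
      have hrtne : r ≠ t := fun heq => hrt' (by rw [heq])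
      rcases h.nested r hr s hs with hrs | hrs | hrs | hrs
      · exact .inl hrs
      · refine .inr ⟨hrs.swap, fun heq => ?_⟩
        rw [heq] at hst
        exact h.not_swap_le ht hrt hst
      · exact absurd (hrs.trans hst) (h.not_swap_le ht hrt)
      · rcases hcov r hr hrs.swap hrt with heq | heq
        · exact .inl (heq ▸ SepLE.refl r)
        · exact absurd heq hrtne

/-- The tree of a nested set `N` of separations. Its edges are the elements of `N`. -/
def tree (h : IsTreeSet G N) : SimpleGraph (nodes N) where
  Adj O O' := ∃ s ∈ N, head N s = O ∧ head N s.swap = O'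
  symm := ⟨fun _ _ ⟨s, hs, h1, h2⟩ => ⟨s.swap, h.swap_mem s hs, h2, by simpa using h1⟩⟩
  loopless := ⟨fun _ ⟨_, hs, h1, h2⟩ =>
    h.notMem_head_swap hs (by rw [h2, ← h1]; exact mem_head_self hs)⟩

/-- The node in which the edge `s` ends. -/
def headNode (N : Set (Set V × Set V)) {s : Set V × Set V} (hs : s ∈ N) : nodes N :=
  ⟨head N s, .inr ⟨s, hs, rfl⟩⟩

theorem tree_adj_headNode (h : IsTreeSet G N) (hs : s ∈ N) :
    h.tree.Adj (headNode N hs) (headNode N (h.swap_mem s hs)) := ⟨s, hs, rfl, rfl⟩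

/-- Induction on the size of the finite interval between `s` and `t`; if nothing lies strictly
between them, the two edges share a node. -/
theorem reachable_of_le (h : IsTreeSet G N) (hs : s ∈ N) (ht : t ∈ N) (hst : SepLE s t) :
    h.tree.Reachable (headNode N hs) (headNode N ht) := by
  induction hn : {r ∈ N | SepLE s r ∧ SepLE r t}.ncard using Nat.strong_induction_on
    generalizing s t with
  | _ n ih =>
    subst hn
    by_cases hne : s = t
    · subst hne; rfl
    by_cases hcov : ∀ r ∈ N, SepLE s r → SepLE r t → r = s ∨ r = t
    · have heq : headNode N hs = headNode N (h.swap_mem t ht) :=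
        Subtype.ext (h.head_eq_of_covers hs ht hst hne hcov)
      rw [heq]
      exact (h.tree_adj_headNode ht).symm.reachable
    · push Not at hcov
      obtain ⟨r, hr, hsr, hrt, hrs, hrt'⟩ := hcov
      refine (ih _ ?_ hs hr hsr rfl).trans (ih _ ?_ hr ht hrt rfl)
      · refine Set.ncard_lt_ncard ⟨fun q hq => ⟨hq.1, hq.2.1, hq.2.2.trans hrt⟩, fun hsub => ?_⟩
          (h.finite_interval hs ht)
        exact hrt' (hrt.antisymm (hsub ⟨ht, hst, SepLE.refl t⟩).2.2)
      · refine Set.ncard_lt_ncard ⟨fun q hq => ⟨hq.1, hsr.trans hq.2.1, hq.2.2⟩, fun hsub => ?_⟩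
          (h.finite_interval hs ht)
        exact hrs ((hsub ⟨hs, SepLE.refl s, hst⟩).2.1.antisymm hsr)

theorem tree_connected (h : IsTreeSet G N) : h.tree.Connected := by
  have hadj : ∀ {s} (hs : s ∈ N), h.tree.Reachable (headNode N hs)
      (headNode N (h.swap_mem s hs)) := fun hs => (h.tree_adj_headNode hs).reachable
  rw [SimpleGraph.connected_iff]
  constructor
  · rintro ⟨_, ⟨hN, rfl⟩ | ⟨s, hs, rfl⟩⟩ ⟨_, ⟨hN', rfl⟩ | ⟨t, ht, rfl⟩⟩
    · rfl
    · rw [hN] at ht; exact ht.elim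
    · rw [hN'] at hs; exact hs.elim
    · change h.tree.Reachable (headNode N hs) (headNode N ht)
      rcases h.nested s hs t ht with hst | hst | hst | hst
      · exact h.reachable_of_le hs ht hst
      · exact (h.reachable_of_le hs (h.swap_mem t ht) hst).trans (hadj ht).symm
      · exact (hadj hs).trans (h.reachable_of_le (h.swap_mem s hs) ht hst)
      · exact (h.reachable_of_le ht hs hst.swap).symm
  · rcases N.eq_empty_or_nonempty with hN | ⟨s, hs⟩
    · exact ⟨∅, .inl ⟨hN, rfl⟩⟩
    · exact ⟨headNode N hs⟩

/-- Only the edge `s` of the tree joins nodes that orient `s` differently. -/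
theorem mem_iff_of_reachable (h : IsTreeSet G N) (hs : s ∈ N) {O O' : nodes N}
    (hr : (h.tree.deleteEdges {s(headNode N hs, headNode N (h.swap_mem s hs))}).Reachable O O') :
    s ∈ O.1 ↔ s ∈ O'.1 := by
  obtain ⟨p⟩ := hr
  induction p with
  | nil => rfl
  | cons hadj p ih =>
    rename_i O₁ O₂ O₃
    rw [← ih]
    rw [SimpleGraph.deleteEdges_adj] at hadj
    obtain ⟨⟨t, ht, h1, h2⟩, hne⟩ := hadj
    rw [← h1, ← h2]
    refine mem_head_iff_mem_head_swap (fun heq => hne ?_) fun heq => hne ?_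
    · subst heq
      obtain rfl : headNode N hs = O₁ := Subtype.ext h1
      obtain rfl : headNode N (h.swap_mem s hs) = O₂ := Subtype.ext h2
      rfl
    · obtain rfl : headNode N hs = O₂ := Subtype.ext (heq ▸ h2)
      obtain rfl : headNode N (h.swap_mem s hs) = O₁ :=
        Subtype.ext (by rw [← h1, ← Prod.swap_swap t, ← heq]; rfl)
      exact Sym2.eq_swap

/-- Every edge is a bridge: its ends orient it differently, whereas moving along other edges never
changes its orientation. -/
theorem tree_isTree (h : IsTreeSet G N) : h.tree.IsTree := by
  refine ⟨h.tree_connected, SimpleGraph.isAcyclic_iff_forall_adj_isBridge.2 ?_⟩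
  rintro O O' ⟨s, hs, h1, h2⟩
  obtain rfl : headNode N hs = O := Subtype.ext h1
  obtain rfl : headNode N (h.swap_mem s hs) = O' := Subtype.ext h2
  rw [SimpleGraph.isBridge_iff]
  exact fun hr => h.notMem_head_swap hs ((h.mem_iff_of_reachable hs hr).1 (mem_head_self hs))

theorem reachable_headNode_iff (h : IsTreeSet G N) (hs : s ∈ N) (O : nodes N) :
    (h.tree.deleteEdges {s(headNode N hs, headNode N (h.swap_mem s hs))}).Reachable
      (headNode N hs) O ↔ s ∈ O.1 := by
  refine ⟨fun hr => (h.mem_iff_of_reachable hs hr).1 (mem_head_self hs), fun hO => ?_⟩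
  have key : ∀ O, h.tree.Walk O (headNode N hs) →
      (h.tree.deleteEdges {s(headNode N hs, headNode N (h.swap_mem s hs))}).Reachable
        (headNode N hs) O ∨
      (h.tree.deleteEdges {s(headNode N hs, headNode N (h.swap_mem s hs))}).Reachable
        (headNode N (h.swap_mem s hs)) O := by
    intro O p
    generalize hhd : headNode N hs = O' at p
    induction p with
    | nil => subst hhd; exact .inl (.refl _)
    | cons hadj p ih =>
      rename_i O₁ O₂ O₃
      subst hhd
      by_cases he : s(O₁, O₂) = s(headNode N hs, headNode N (h.swap_mem s hs))
      · rcases Sym2.eq_iff.1 he with ⟨rfl, -⟩ | ⟨rfl, -⟩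
        · exact .inl (.refl _)
        · exact .inr (.refl _)
      · have hadj' : (h.tree.deleteEdges
            {s(headNode N hs, headNode N (h.swap_mem s hs))}).Adj O₂ O₁ :=
          (SimpleGraph.deleteEdges_adj.2 ⟨hadj, he⟩).symm
        exact (ih rfl).imp (·.trans hadj'.reachable) (·.trans hadj'.reachable)
  refine (key O (h.tree_connected.preconnected O _).some).resolve_right fun hr => ?_
  exact h.notMem_head_swap hs ((h.mem_iff_of_reachable hs hr).2 hO)

/-- The node is the head of a maximal `r ≥ s` in `N` with both vertices in `r.2`; only finitely many
candidates exist, as each separates a vertex of `s.1` from `v`. If `r < q.swap`, maximality keeps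
`v` and `w` from lying both in `q.1`, and being equal or adjacent they then lie both in `q.2`. -/
theorem exists_node_of_mem_snd (h : IsTreeSet G N) (hs : s ∈ N) {v w : V}
    (hvw : v = w ∨ G.Adj v w) (hv : v ∈ s.2) (hw : w ∈ s.2) :
    ∃ O : nodes N, s ∈ O.1 ∧ ∀ r ∈ O.1, v ∈ r.2 ∧ w ∈ r.2 := by
  obtain ⟨x, hx⟩ := h.exists_mem_fst hs
  obtain ⟨r, ⟨hrN, hsr, hvr, hwr⟩, hmax⟩ := Set.Finite.exists_maximalFor
    (fun r : Set V × Set V => (r.1, OrderDual.toDual r.2))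
    {r ∈ N | SepLE s r ∧ v ∈ r.2 ∧ w ∈ r.2}
    ((h.finite_separating x v).subset fun r hr => ⟨hr.1, hr.2.1.1 hx, hr.2.2.1⟩)
    ⟨s, hs, SepLE.refl s, hv, hw⟩
  refine ⟨headNode N hrN, ⟨hs, .inl hsr⟩, ?_⟩
  rintro q ⟨hqN, hq | ⟨hq, hq'⟩⟩
  · exact ⟨hq.2 hvr, hq.2 hwr⟩
  · have hnot : ¬ (v ∈ q.1 ∧ w ∈ q.1) := fun hvwq =>
      hq' (hq.antisymm (hmax (j := q.swap) ⟨h.swap_mem q hqN, hsr.trans hq, hvwq⟩ hq))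
    have hsep := h.isSeparation q hqN
    rcases hvw with rfl | hvw
    · have := (hsep.mem_or v).resolve_left fun hv => hnot ⟨hv, hv⟩
      exact ⟨this, this⟩
    · by_cases hvq : v ∈ q.1
      · have hwq : w ∉ q.1 := fun hwq => hnot ⟨hvq, hwq⟩
        exact ⟨hsep.swap.mem_of_adj hvw.symm hwq, (hsep.mem_or w).resolve_left hwq⟩
      · exact ⟨(hsep.mem_or v).resolve_left hvq, hsep.swap.mem_of_adj hvw hvq⟩

theorem exists_node (h : IsTreeSet G N) {v w : V} (hvw : v = w ∨ G.Adj v w) :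
    ∃ O : nodes N, ∀ r ∈ O.1, v ∈ r.2 ∧ w ∈ r.2 := by
  rcases N.eq_empty_or_nonempty with hN | ⟨s, hs⟩
  · exact ⟨⟨∅, .inl ⟨hN, rfl⟩⟩, fun r hr => hr.elim⟩
  · have hside : (v ∈ s.2 ∧ w ∈ s.2) ∨ (v ∈ s.swap.2 ∧ w ∈ s.swap.2) := by
      have hsep := h.isSeparation s hs
      rcases hvw with rfl | hvw
      · exact (hsep.mem_or v).symm.imp (fun h => ⟨h, h⟩) fun h => ⟨h, h⟩
      · by_cases hv : v ∈ s.2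
        · by_cases hw : w ∈ s.2
          · exact .inl ⟨hv, hw⟩
          · exact .inr ⟨hsep.mem_of_adj hvw.symm hw, (hsep.mem_or w).resolve_right hw⟩
        · exact .inr ⟨(hsep.mem_or v).resolve_right hv, hsep.mem_of_adj hvw hv⟩
    rcases hside with hside | hside
    · obtain ⟨O, -, hO⟩ := h.exists_node_of_mem_snd hs hvw hside.1 hside.2
      exact ⟨O, hO⟩
    · obtain ⟨O, -, hO⟩ := h.exists_node_of_mem_snd (h.swap_mem s hs) hvw hside.1 hside.2
      exact ⟨O, hO⟩

/-- The tree-decomposition of a nested set of separations. -/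
def treeDecomposition (h : IsTreeSet G N) : TreeDecomposition G where
  Node := nodes N
  tree := h.tree
  isTree := h.tree_isTree
  part O := ⋂ s ∈ O.1, s.2
  iUnion_part := by
    refine Set.eq_univ_of_forall fun v => ?_
    obtain ⟨O, hO⟩ := h.exists_node (v := v) (.inl rfl)
    exact Set.mem_iUnion.2 ⟨O, Set.mem_iInter₂.2 fun r hr => (hO r hr).1⟩
  exists_part_of_adj := by
    intro v w hvw
    obtain ⟨O, hO⟩ := h.exists_node (.inr hvw)
    exact ⟨O, Set.mem_iInter₂.2 fun r hr => (hO r hr).1, Set.mem_iInter₂.2 fun r hr => (hO r hr).2⟩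
  inter_subset := by
    classical
    rintro O₁ O₂ O₃ p hp hO₂ v ⟨hv1, hv3⟩
    refine Set.mem_iInter₂.2 fun r hr => ?_
    by_cases hr1 : r ∈ O₁.1
    · exact Set.mem_iInter₂.1 hv1 r hr1
    by_cases hr3 : r ∈ O₃.1
    · exact Set.mem_iInter₂.1 hv3 r hr3
    -- If `r` belongs to `O₂` but to neither end of the path, the path must use the edge `r` both
    -- before and after `O₂`.
    have hrN : r ∈ N := subset_of_mem_nodes O₂.2 hr
    let e := s(headNode N hrN, headNode N (h.swap_mem r hrN))
    have h1 : e ∈ (p.takeUntil O₂ hO₂).edges :=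
      (p.takeUntil O₂ hO₂).mem_edges_of_not_reachable_deleteEdges fun hreach =>
        hr1 ((h.mem_iff_of_reachable hrN hreach).2 hr)
    have h2 : e ∈ (p.dropUntil O₂ hO₂).edges :=
      (p.dropUntil O₂ hO₂).mem_edges_of_not_reachable_deleteEdges fun hreach =>
        hr3 ((h.mem_iff_of_reachable hrN hreach).1 hr)
    exact (hp.isTrail.disjoint_edges_takeUntil_dropUntil hO₂ h1 h2).elim

/-- The nodes on the side of `headNode N hs` are those containing `s`, so their parts lie in `s.2`;
this is where the swap comes from. -/
theorem inducedSeparation_headNode (h : IsTreeSet G N) (hs : s ∈ N) :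
    h.treeDecomposition.inducedSeparation (headNode N hs) (headNode N (h.swap_mem s hs)) =
      s.swap := by
  have key : ∀ {s} (hs : s ∈ N), (⋃ O ∈ h.treeDecomposition.side (headNode N hs)
      (headNode N (h.swap_mem s hs)), h.treeDecomposition.part O) = s.2 := by
    intro s hs
    refine Set.Subset.antisymm (Set.iUnion₂_subset fun O hO => ?_) fun v hv => ?_
    · exact Set.biInter_subset_of_mem ((h.reachable_headNode_iff hs O).1 hO)
    · obtain ⟨O, hsO, hO⟩ := h.exists_node_of_mem_snd hs (.inl rfl) hv hv
      exact Set.mem_iUnion₂.2 ⟨O, (h.reachable_headNode_iff hs O).2 hsO,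
        Set.mem_iInter₂.2 fun r hr => (hO r hr).1⟩
  exact Prod.ext (key hs) (key (h.swap_mem s hs))

theorem distinguishesPair (h : IsTreeSet G N) (hs : s ∈ N) {P P' : Set (Set V × Set V)}
    (hP : DistinguishesEfficiently G s P P') : h.treeDecomposition.DistinguishesPair P P' :=
  ⟨headNode N hs, headNode N (h.swap_mem s hs), h.tree_adj_headNode hs, by
    rw [h.inducedSeparation_headNode hs]; exact hP.swap⟩

end IsTreeSet

theorem IsAdmissible.isTreeSet {k : ℕ} {𝓟 : Set (Set (Set V × Set V))} (h : IsAdmissible k G 𝓟) :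
    IsTreeSet G (canonicalSet G 𝓟) where
  isSeparation _ hs := (h.isTight_of_mem_canonicalSet hs).1.1
  swap_mem _ hs := swap_mem_canonicalSet hs
  nested _ hs _ ht := h.nested_canonicalSet hs ht
  not_subset _ hs := (h.isTight_of_mem_canonicalSet hs).1.not_subset
  finite_separating v w :=
    (finite_isTight_separating h.connected h.locallyFinite k v w).subset fun _ hs =>
      ⟨(h.isTight_of_mem_canonicalSet hs.1).1, (h.isTight_of_mem_canonicalSet hs.1).2, hs.2⟩

/-! ### Naturality under graph isomorphisms -/

variable {V' : Type u} {G' : SimpleGraph V'}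

/-- The bijection between pairs of vertex sets induced by a bijection between vertices. -/
def sepMap (e : V ≃ V') : Set V × Set V ≃ Set V' × Set V' :=
  (Equiv.Set.congr e).prodCongr (Equiv.Set.congr e)

theorem sepMap_apply (e : V ≃ V') (s : Set V × Set V) : sepMap e s = (e '' s.1, e '' s.2) := rfl

theorem sepMap_swap (e : V ≃ V') (s : Set V × Set V) : sepMap e s.swap = (sepMap e s).swap := rfl

theorem mapProfiles_eq (φ : G ≃g G') (𝓟 : Set (Set (Set V × Set V))) :
    mapProfiles φ 𝓟 = Set.image (sepMap φ.toEquiv) '' 𝓟 := rfl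

theorem isSeparation_sepMap (φ : G ≃g G') {s : Set V × Set V} :
    IsSeparation G' (sepMap φ.toEquiv s) ↔ IsSeparation G s := by
  have h1 : (sepMap φ.toEquiv s).1 ∪ (sepMap φ.toEquiv s).2 = φ '' (s.1 ∪ s.2) :=
    (Set.image_union _ _ _).symm
  unfold IsSeparation
  rw [h1, ← Set.image_univ_of_surjective φ.surjective, Set.image_eq_image φ.injective,
    sepMap_apply, ← Set.image_sdiff φ.toEquiv.injective, ← Set.image_sdiff φ.toEquiv.injective]
  simp only [Set.forall_mem_image]
  refine and_congr_right fun _ => forall₄_congr fun a _ b _ => not_congr ?_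
  exact φ.map_adj_iff

theorem order_sepMap (e : V ≃ V') (s : Set V × Set V) : order (sepMap e s) = order s := by
  unfold order
  rw [sepMap_apply, ← Set.image_inter e.injective, e.injective.encard_image]

theorem sepLE_sepMap (e : V ≃ V') {s t : Set V × Set V} :
    SepLE (sepMap e s) (sepMap e t) ↔ SepLE s t :=
  and_congr (Set.image_subset_image_iff e.injective) (Set.image_subset_image_iff e.injective)

theorem nested_sepMap (e : V ≃ V') (s t : Set V × Set V) :
    Nested (sepMap e s) (sepMap e t) ↔ Nested s t := by
  simp only [Nested, ← sepMap_swap, sepLE_sepMap]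

theorem distinguishesEfficiently_sepMap (φ : G ≃g G') {s : Set V × Set V}
    {P P' : Set (Set V × Set V)} :
    DistinguishesEfficiently G' (sepMap φ.toEquiv s) (sepMap φ.toEquiv '' P)
      (sepMap φ.toEquiv '' P') ↔ DistinguishesEfficiently G s P P' := by
  have hd : ∀ t, Distinguishes (sepMap φ.toEquiv t) (sepMap φ.toEquiv '' P)
      (sepMap φ.toEquiv '' P') ↔ Distinguishes t P P' := by
    intro t
    simp only [Distinguishes, ← sepMap_swap, (sepMap φ.toEquiv).injective.mem_set_image]
  simp only [DistinguishesEfficiently, (sepMap φ.toEquiv).surjective.forall, isSeparation_sepMap,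
    hd, order_sepMap]

theorem distinguisherFamily_map (φ : G ≃g G') (𝓟 : Set (Set (Set V × Set V))) (n : ℕ) :
    distinguisherFamily G' (mapProfiles φ 𝓟) n =
      Set.image (sepMap φ.toEquiv) '' distinguisherFamily G 𝓟 n := by
  have hinj := Set.image_injective.2 (sepMap φ.toEquiv).injective
  have himg : ∀ P P', {s | DistinguishesEfficiently G' s (sepMap φ.toEquiv '' P)
      (sepMap φ.toEquiv '' P')} = sepMap φ.toEquiv '' {s | DistinguishesEfficiently G s P P'} := by
    intro P P'
    ext s
    obtain ⟨s, rfl⟩ := (sepMap φ.toEquiv).surjective s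
    rw [(sepMap φ.toEquiv).injective.mem_set_image]
    exact distinguishesEfficiently_sepMap φ
  ext X
  obtain ⟨X, rfl⟩ := Set.image_surjective.2 (sepMap φ.toEquiv).surjective X
  rw [hinj.mem_set_image, mapProfiles_eq]
  simp only [distinguisherFamily, Set.mem_ofPred_eq, Set.exists_mem_image, himg, hinj.ne_iff,
    hinj.eq_iff, order_sepMap]

theorem canonicalSet_map (φ : G ≃g G') (𝓟 : Set (Set (Set V × Set V))) :
    canonicalSet G' (mapProfiles φ 𝓟) = sepMap φ.toEquiv '' canonicalSet G 𝓟 := by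
  unfold canonicalSet
  rw [Set.image_iUnion]
  exact Set.iUnion_congr fun n => splinterLevel_image _ (nested_sepMap _)
    (distinguisherFamily_map φ 𝓟) n

theorem head_image (e : V ≃ V') (N : Set (Set V × Set V)) (s : Set V × Set V) :
    head (sepMap e '' N) (sepMap e s) = sepMap e '' head N s := by
  ext r
  obtain ⟨r, rfl⟩ := (sepMap e).surjective r
  simp only [head, Set.mem_ofPred_eq, (sepMap e).injective.mem_set_image, ← sepMap_swap,
    sepLE_sepMap, (sepMap e).injective.ne_iff]

theorem image_mem_nodes_iff (e : V ≃ V') {N O : Set (Set V × Set V)} :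
    sepMap e '' O ∈ nodes (sepMap e '' N) ↔ O ∈ nodes N := by
  simp only [nodes, Set.mem_ofPred_eq, Set.image_eq_empty, Set.exists_mem_image, head_image,
    Set.image_eq_image (sepMap e).injective]

namespace IsTreeSet

variable {N : Set (Set V × Set V)} {N' : Set (Set V' × Set V')}

/-- The isomorphism of trees induced by an isomorphism of graphs. -/
def treeIso (h : IsTreeSet G N) (h' : IsTreeSet G' N') (e : V ≃ V') (hN : N' = sepMap e '' N) :
    h.tree ≃g h'.tree where
  toEquiv := (Equiv.Set.congr (sepMap e)).subtypeEquiv fun _ => by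
    rw [hN]; exact (image_mem_nodes_iff e).symm
  map_rel_iff' := by
    subst hN
    rintro ⟨O, hO⟩ ⟨O', hO'⟩
    change (∃ s ∈ sepMap e '' N, head _ s = sepMap e '' O ∧ head _ s.swap = sepMap e '' O') ↔
      ∃ s ∈ N, head N s = O ∧ head N s.swap = O'
    simp only [Set.exists_mem_image, ← sepMap_swap, head_image,
      Set.image_eq_image (sepMap e).injective]

theorem treeIso_apply_coe (h : IsTreeSet G N) (h' : IsTreeSet G' N') (e : V ≃ V')
    (hN : N' = sepMap e '' N) (O : nodes N) : (h.treeIso h' e hN O).1 = sepMap e '' O.1 := rfl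

theorem part_treeIso (h : IsTreeSet G N) (h' : IsTreeSet G' N') (e : V ≃ V')
    (hN : N' = sepMap e '' N) (O : nodes N) :
    h'.treeDecomposition.part (h.treeIso h' e hN O) = e '' h.treeDecomposition.part O := by
  change ⋂ s ∈ sepMap e '' O.1, s.2 = e '' ⋂ s ∈ O.1, s.2
  rw [Set.biInter_image, Set.image_iInter₂ e.bijective]
  rfl

end IsTreeSet

/-- The canonical tree-decomposition that distinguishes the profiles in `𝓟` efficiently. -/
def canonicalTreeDecomposition {k : ℕ} {𝓟 : Set (Set (Set V × Set V))} (h : IsAdmissible k G 𝓟) :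
    TreeDecomposition G :=
  h.isTreeSet.treeDecomposition

/-- Nodes are sets of separations on which isomorphisms act by images, so functoriality is that of
images. -/
theorem isCanonical_canonicalTreeDecomposition (k : ℕ) :
    IsCanonical (C := fun _ G 𝓟 => IsAdmissible k G 𝓟)
      fun (V : Type u) (G : SimpleGraph V) (𝓟 : Set (Set (Set V × Set V)))
        (h : IsAdmissible k G 𝓟) => canonicalTreeDecomposition h := by
  refine ⟨fun V V' G G' 𝓟 𝓟' h h' φ hφ => h.isTreeSet.treeIso h'.isTreeSet φ.toEquiv
    (by rw [← hφ, canonicalSet_map]), ?_, ?_, ?_⟩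
  · intro V V' G G' 𝓟 𝓟' h h' φ hφ t
    exact IsTreeSet.part_treeIso _ _ _ _ t
  · intro V G 𝓟 h hid t
    refine Subtype.ext ((IsTreeSet.treeIso_apply_coe _ _ _ _ t).trans ?_)
    have : ∀ s : Set V × Set V, sepMap (SimpleGraph.Iso.refl : G ≃g G).toEquiv s = s :=
      fun s => Prod.ext (Set.image_id _) (Set.image_id _)
    rw [Set.image_congr fun s _ => this s, Set.image_id']
  · intro V V' V'' G G' G'' 𝓟 𝓟' 𝓟'' h h' h'' φ χ hφ hχ hc t
    refine Subtype.ext ((IsTreeSet.treeIso_apply_coe _ _ _ _ t).trans ?_)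
    refine Eq.trans ?_ (IsTreeSet.treeIso_apply_coe _ _ _ _ _).symm
    refine Eq.trans ?_ (congrArg (Set.image (sepMap χ.toEquiv))
      (IsTreeSet.treeIso_apply_coe _ _ _ _ t)).symm
    rw [← Set.image_comp]
    exact Set.image_congr fun s _ => Prod.ext (Set.image_comp χ φ s.1) (Set.image_comp χ φ s.2)

theorem distinguishesPair_canonicalTreeDecomposition {k : ℕ} {𝓟 : Set (Set (Set V × Set V))}
    (h : IsAdmissible k G 𝓟) {P P' : Set (Set V × Set V)} (hP : P ∈ 𝓟) (hP' : P' ∈ 𝓟)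
    (hne : P ≠ P') : (canonicalTreeDecomposition h).DistinguishesPair P P' := by
  obtain ⟨s, hs, hsd⟩ := h.exists_mem_canonicalSet hP hP' hne
  exact h.isTreeSet.distinguishesPair hs hsd

/-! ### Ends -/

/-- The separations of order at most `k` that point towards the end of the ray `R`. -/
def rayProfile (k : ℕ) (R : Ray G) : Set (Set V × Set V) :=
  {s | IsSeparation G s ∧ order s ≤ k ∧ R.TailIn s.2}

theorem Ray.tailIn_compl (R : Ray G) {S : Set V} (hS : S.Finite) : R.TailIn Sᶜ := by
  have := R.injective.tendsto_cofinite.eventually hS.compl_mem_cofinite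
  rwa [Nat.cofinite_eq_atTop] at this

theorem Ray.TailIn.mono {R : Ray G} {X Y : Set V} (h : R.TailIn X) (hXY : X ⊆ Y) : R.TailIn Y :=
  Filter.Eventually.mono h fun _ hn => hXY hn

theorem Ray.TailIn.exists_mem {R : Ray G} {X Y : Set V} (h : R.TailIn X) (h' : R.TailIn Y) :
    ∃ v, v ∈ X ∧ v ∈ Y := by
  obtain ⟨n, hn⟩ := (Filter.Eventually.and h h').exists
  exact ⟨_, hn⟩

theorem Ray.TailIn.diff {R : Ray G} {s : Set V × Set V} (h : R.TailIn s.2)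
    (hfin : (s.1 ∩ s.2).Finite) : R.TailIn (s.2 \ s.1) :=
  (Filter.Eventually.and h (R.tailIn_compl hfin)).mono fun _ hn => ⟨hn.1, fun h => hn.2 ⟨h, hn.1⟩⟩

theorem Ray.exists_component (R : Ray G) {S : Set V} (hS : S.Finite) :
    ∃ K : G.ComponentCompl S, R.TailIn K := by
  obtain ⟨n, hn⟩ := Filter.eventually_atTop.1 (R.tailIn_compl hS)
  refine ⟨G.componentComplMk (hn n le_rfl), Filter.eventually_atTop.2 ⟨n, fun m hm => ?_⟩⟩
  induction m, hm using Nat.le_induction with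
  | base => exact G.componentComplMk_mem _
  | succ m hm ih =>
    exact SimpleGraph.ComponentCompl.mem_of_adj _ _ ih (hn (m + 1) (hm.trans m.le_succ)) (R.adj m)

theorem IsSeparation.component_subset {s : Set V × Set V} (hs : IsSeparation G s)
    (K : G.ComponentCompl (s.1 ∩ s.2)) {v : V} (hv : v ∈ K) (hv2 : v ∈ s.2) : (K : Set V) ⊆ s.2 := by
  rintro w ⟨hw, rfl⟩
  obtain ⟨hvS, hvK⟩ := hv
  obtain ⟨p⟩ := SimpleGraph.ConnectedComponent.exact hvK
  have key : ∀ a b : ↥(s.1 ∩ s.2)ᶜ, (G.induce (s.1 ∩ s.2)ᶜ).Walk a b → a.1 ∈ s.2 → b.1 ∈ s.2 := by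
    intro a b p ha
    induction p with
    | nil => exact ha
    | cons hadj p ih =>
      rename_i a b c
      exact ih (hs.swap.mem_of_adj hadj fun h => a.2 ⟨h, ha⟩)
  exact key _ _ p hv2

theorem Ray.tailIn_snd_or_fst (R : Ray G) {s : Set V × Set V} (hs : IsSeparation G s)
    (hfin : (s.1 ∩ s.2).Finite) : R.TailIn s.2 ∨ R.TailIn s.1 := by
  obtain ⟨n, hn⟩ := Filter.eventually_atTop.1 (R.tailIn_compl hfin)
  have key : ∀ t : Set V × Set V, IsSeparation G t → t.1 ∩ t.2 = s.1 ∩ s.2 → R.vertex n ∈ t.2 →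
      R.TailIn t.2 := by
    intro t ht hts hn2
    refine Filter.eventually_atTop.2 ⟨n, fun m hm => ?_⟩
    induction m, hm using Nat.le_induction with
    | base => exact hn2
    | succ m hm ih => exact ht.swap.mem_of_adj (R.adj m) fun h => hn m hm (hts ▸ ⟨h, ih⟩)
  rcases hs.mem_or (R.vertex n) with h | h
  · exact .inr (key s.swap hs.swap (Set.inter_comm _ _) h)
  · exact .inl (key s hs rfl h)

theorem finite_inter_of_order_le {k : ℕ} {s : Set V × Set V} (h : order s ≤ k) :
    (s.1 ∩ s.2).Finite :=
  Set.finite_of_encard_le_coe h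

theorem isProfileOfOrder_rayProfile (k : ℕ) (R : Ray G) :
    IsProfileOfOrder G (k + 1) (rayProfile k R) where
  isProfile :=
    { isSeparation := fun s hs => hs.1
      consistent := by
        rintro s t - - hts ⟨-, hs, hsR⟩ ⟨-, ht, htR⟩
        obtain ⟨v, hv, hv'⟩ := (hsR.diff (finite_inter_of_order_le hs)).exists_mem htR
        exact hv.2 (hts.1 hv')
      corner := by
        rintro s ⟨-, hs, hsR⟩ t ⟨-, ht, htR⟩ ⟨-, -, hR⟩
        obtain ⟨n, ⟨h1, h2⟩, h3⟩ := (Filter.Eventually.and (Filter.Eventually.and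
          (hsR.diff (finite_inter_of_order_le hs)) (htR.diff (finite_inter_of_order_le ht)))
          hR).exists
        exact h3.elim h1.2 h2.2 }
  order_lt s hs := (ENat.lt_add_one_iff (ENat.natCast_ne_top k)).2 hs.2.1
  mem_or_swap_mem s hs hord := by
    have hord := (ENat.lt_add_one_iff (ENat.natCast_ne_top k)).1 hord
    exact (R.tailIn_snd_or_fst hs (finite_inter_of_order_le hord)).imp (fun h => ⟨hs, hord, h⟩)
      fun h => ⟨hs.swap, by simpa using hord, h⟩

/-- A late vertex of `R` lies in `s.2 \ s.1`. If both corners belonged to the profile, one would put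
this vertex outside `t.1` and the other inside. -/
theorem isRobust_rayProfile (k : ℕ) (R : Ray G) : IsRobust G (rayProfile k R) := by
  rintro n s ⟨-, hs, hsR⟩ t ht htn - - ⟨⟨-, h1, h1R⟩, -, h2, h2R⟩
  obtain ⟨m, ⟨hm, hm1⟩, hm2⟩ := (Filter.Eventually.and (Filter.Eventually.and
    (hsR.diff (finite_inter_of_order_le hs)) (h1R.diff (finite_inter_of_order_le h1))) h2R).exists
  exact hm2.elim hm.2 fun h => hm1.2 ⟨hm.1, h⟩

/-- Truncation at order `k` is what gives pairwise `k`-distinguishability: distinct truncated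
profiles differ on a separation of order at most `k`, which both of them orient. -/
theorem isAdmissible_range_rayProfile (k : ℕ) (hG : G.Connected) (hlf : IsLocallyFinite G) :
    IsAdmissible k G (Set.range (rayProfile (G := G) k)) where
  connected := hG
  locallyFinite := hlf
  isProfile := by
    rintro _ ⟨R, rfl⟩
    exact ⟨_, isProfileOfOrder_rayProfile k R⟩
  robust := by
    rintro _ ⟨R, rfl⟩
    exact isRobust_rayProfile k R
  distinguishable := by
    have key : ∀ {R R' : Ray G} {s}, s ∈ rayProfile k R → s ∉ rayProfile k R' →
        s.swap ∈ rayProfile k R' := fun {R R' s} hs hs' =>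
      ((isProfileOfOrder_rayProfile k R').mem_or_swap_mem s hs.1
        ((isProfileOfOrder_rayProfile k R).order_lt s hs)).resolve_left hs'
    rintro _ ⟨R, rfl⟩ _ ⟨R', rfl⟩ hne
    obtain ⟨s, hs⟩ : ∃ s, ¬ (s ∈ rayProfile k R ↔ s ∈ rayProfile k R') := by
      by_contra! hcon
      exact hne (Set.ext hcon)
    by_cases hR : s ∈ rayProfile k R
    · have hR' : s ∉ rayProfile k R' := fun h => hs (iff_of_true hR h)
      exact ⟨s, hR.1, hR.2.1, .inl ⟨hR, key hR hR'⟩⟩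
    · have hR' : s ∈ rayProfile k R' := by_contra fun h => hs (iff_of_false hR h)
      exact ⟨s, hR'.1, hR'.2.1, .inr ⟨key hR' hR, hR'⟩⟩

/-- The image of a ray under an isomorphism. -/
def Ray.map (φ : G ≃g G') (R : Ray G) : Ray G' where
  vertex n := φ (R.vertex n)
  injective := φ.injective.comp R.injective
  adj n := φ.map_adj_iff.2 (R.adj n)

theorem rayProfile_map (φ : G ≃g G') (k : ℕ) (R : Ray G) :
    rayProfile k (R.map φ) = sepMap φ.toEquiv '' rayProfile k R := by
  ext s
  obtain ⟨s, rfl⟩ := (sepMap φ.toEquiv).surjective s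
  rw [(sepMap φ.toEquiv).injective.mem_set_image]
  refine and_congr (isSeparation_sepMap φ) (and_congr (by rw [order_sepMap]) ?_)
  exact Filter.eventually_congr (.of_forall fun n => φ.injective.mem_set_image)

theorem mapProfiles_range_rayProfile (φ : G ≃g G') (k : ℕ) :
    mapProfiles φ (Set.range (rayProfile (G := G) k)) = Set.range (rayProfile (G := G') k) := by
  rw [mapProfiles_eq]
  ext P
  constructor
  · rintro ⟨_, ⟨R, rfl⟩, rfl⟩
    exact ⟨R.map φ, rayProfile_map φ k R⟩
  · rintro ⟨R, rfl⟩
    refine ⟨_, ⟨R.map φ.symm, rfl⟩, ?_⟩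
    rw [← rayProfile_map]
    congr 1
    cases R
    simp [Ray.map]

theorem Ray.equivalent_refl (R : Ray G) : Ray.Equivalent R R := fun _ hS =>
  (R.exists_component hS).imp fun _ h => ⟨h, h⟩

/-- Equivalent rays have their tails in one component, which lies entirely on one side of `s`, so a
single ray decides membership. -/
theorem mem_endProfile_iff (R : Ray G) {s : Set V × Set V} (hs : IsSeparation G s)
    (hfin : (s.1 ∩ s.2).Finite) :
    s ∈ endProfile G {R' | Ray.Equivalent R R'} ↔ R.TailIn s.2 := by
  constructor
  · rintro ⟨-, -, K, hK, hKs⟩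
    exact (hK R R.equivalent_refl).mono hKs
  · intro hR
    obtain ⟨K, hK⟩ := R.exists_component hfin
    refine ⟨hs, hfin, K, fun R' hR' => ?_, ?_⟩
    · obtain ⟨K', hRK', hR'K'⟩ := hR' _ hfin
      obtain ⟨v, hv, hv'⟩ := hK.exists_mem hRK'
      have : K = K' := by
        by_contra hne
        exact Set.disjoint_left.1 (SimpleGraph.ComponentCompl.pairwise_disjoint hne) hv hv'
      exact this ▸ hR'K'
    · obtain ⟨v, hv, hv'⟩ := hK.exists_mem hR
      exact hs.component_subset K hv hv'

/-- Truncated and full end profiles agree up to order `k`, and any separation of order below that of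
`s` stays within this range. -/
theorem distinguishesEfficiently_endProfile {k : ℕ} {R R' : Ray G} {s : Set V × Set V}
    (h : DistinguishesEfficiently G s (rayProfile k R) (rayProfile k R')) :
    DistinguishesEfficiently G s (endProfile G {R₁ | Ray.Equivalent R R₁})
      (endProfile G {R₁ | Ray.Equivalent R' R₁}) := by
  have hsub : ∀ (R : Ray G) (t : Set V × Set V), t ∈ rayProfile k R →
      t ∈ endProfile G {R₁ | Ray.Equivalent R R₁} := fun R t ht =>
    (mem_endProfile_iff R ht.1 (finite_inter_of_order_le ht.2.1)).2 ht.2.2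
  have hsup : ∀ (R : Ray G) (t : Set V × Set V), order t ≤ k →
      t ∈ endProfile G {R₁ | Ray.Equivalent R R₁} → t ∈ rayProfile k R := fun R t hord ht =>
    ⟨ht.1, hord, (mem_endProfile_iff R ht.1 ht.2.1).1 ht⟩
  have hsk : order s ≤ k := by
    rcases h.2.1 with h | h
    · exact h.1.2.1
    · exact h.2.2.1
  refine ⟨h.1, h.2.1.imp (.imp (hsub _ _) (hsub _ _)) (.imp (hsub _ _) (hsub _ _)),
    fun t ht htd => ?_⟩
  by_contra! hlt
  have htk : order t ≤ k := hlt.le.trans hsk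
  have htk' : order t.swap ≤ k := by simpa using htk
  refine (h.2.2 t ht ?_).not_gt hlt
  exact htd.imp (.imp (hsup _ _ htk) (hsup _ _ htk')) (.imp (hsup _ _ htk') (hsup _ _ htk))

theorem rayProfile_ne {k : ℕ} {R R' : Ray G} {S : Set V} (hS : S.encard ≤ k)
    {K K' : G.ComponentCompl S} (hK : R.TailIn K) (hK' : R'.TailIn K') (hne : K ≠ K') :
    rayProfile k R ≠ rayProfile k R' := by
  -- The component `K` with `S` attached, against everything outside `K`: its separator lies in `S`,
  -- and the two rays point to different sides.
  have hsep : IsSeparation G ((K : Set V)ᶜ, (K : Set V) ∪ S) := by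
    refine isSeparation_of (fun v => ?_) fun v w hvw hv hw => hv (.inl ?_)
    · by_cases hv : v ∈ (K : Set V)
      · exact .inr (.inl hv)
      · exact .inl hv
    · exact SimpleGraph.ComponentCompl.mem_of_adj w v hw (fun h => hv (.inr h)) hvw.symm
  have hord : order ((K : Set V)ᶜ, (K : Set V) ∪ S) ≤ k := by
    refine le_trans (Set.encard_le_encard ?_) hS
    rintro v ⟨hv, hv' | hv'⟩
    · exact absurd hv' hv
    · exact hv'
  have hR : ((K : Set V)ᶜ, (K : Set V) ∪ S) ∈ rayProfile k R :=
    ⟨hsep, hord, hK.mono Set.subset_union_left⟩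
  have hR' : ((K : Set V)ᶜ, (K : Set V) ∪ S).swap ∈ rayProfile k R' :=
    ⟨hsep.swap, (order_swap _).trans_le hord, hK'.mono fun v hv' hv =>
      Set.disjoint_left.1 (SimpleGraph.ComponentCompl.pairwise_disjoint hne) hv hv'⟩
  exact fun heq => (isProfileOfOrder_rayProfile k R').swap_notMem (heq ▸ hR) hR'

end CanonicalTD

theorem theorem7p3 (k : ℕ) :
    (∃ ψ : ∀ ⦃V : Type u⦄ (G : SimpleGraph V) (𝓟 : Set (Set (Set V × Set V))),
        CanonicalTD.IsAdmissible k G 𝓟 → CanonicalTD.TreeDecomposition G,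
      CanonicalTD.IsCanonical
        (C := fun _ G 𝓟 => CanonicalTD.IsAdmissible k G 𝓟) ψ ∧
      ∀ ⦃V : Type u⦄ (G : SimpleGraph V) (𝓟 : Set (Set (Set V × Set V)))
        (h : CanonicalTD.IsAdmissible k G 𝓟), ∀ P ∈ 𝓟, ∀ P' ∈ 𝓟, P ≠ P' →
        (ψ G 𝓟 h).DistinguishesPair P P') ∧
    (∃ ψ : ∀ ⦃V : Type u⦄ (G : SimpleGraph V),
        G.Connected ∧ CanonicalTD.IsLocallyFinite G → CanonicalTD.TreeDecomposition G,
      CanonicalTD.IsCanonicalForGraphs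
        (C := fun _ G => G.Connected ∧ CanonicalTD.IsLocallyFinite G) ψ ∧
      ∀ ⦃V : Type u⦄ (G : SimpleGraph V) (h : G.Connected ∧ CanonicalTD.IsLocallyFinite G),
        ∀ ω ω' : Set (CanonicalTD.Ray G), CanonicalTD.IsEnd G ω → CanonicalTD.IsEnd G ω' →
        CanonicalTD.EndsDistinguishable G k ω ω' →
        (ψ G h).DistinguishesPair (CanonicalTD.endProfile G ω) (CanonicalTD.endProfile G ω')) := by
  refine ⟨⟨_, CanonicalTD.isCanonical_canonicalTreeDecomposition k,
    fun V G 𝓟 h P hP P' hP' hne =>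
      CanonicalTD.distinguishesPair_canonicalTreeDecomposition h hP hP' hne⟩,
    -- The set of all truncated ray profiles is determined by the graph, so isomorphisms preserve it
    -- and canonicity carries over.
    fun V G h => CanonicalTD.canonicalTreeDecomposition
      (CanonicalTD.isAdmissible_range_rayProfile k h.1 h.2), ?_, ?_⟩
  · obtain ⟨ind, hpart, hid, hcomp⟩ := CanonicalTD.isCanonical_canonicalTreeDecomposition.{u} k
    have hmap := fun {V V' : Type u} {G : SimpleGraph V} {G' : SimpleGraph V'} (φ : G ≃g G') =>
      CanonicalTD.mapProfiles_range_rayProfile φ k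
    refine ⟨fun V V' G G' h h' φ => ind _ _ φ (hmap φ), fun V V' G G' h h' φ t => ?_,
      fun V G h t => ?_, fun V V' V'' G G' G'' h h' h'' φ χ t => ?_⟩
    · exact hpart _ _ φ (hmap φ) t
    · exact hid _ _ t
    · exact hcomp _ _ _ φ χ (hmap φ) (hmap χ) _ t
  · rintro V G h _ _ ⟨R, rfl⟩ ⟨R', rfl⟩ ⟨S, hS, K, K', hK, hK', hne⟩
    obtain ⟨s, t, hst, hd⟩ := CanonicalTD.distinguishesPair_canonicalTreeDecomposition
      (CanonicalTD.isAdmissible_range_rayProfile k h.1 h.2) ⟨R, rfl⟩ ⟨R', rfl⟩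
      (CanonicalTD.rayProfile_ne hS (hK R R.equivalent_refl) (hK' R' R'.equivalent_refl) hne)
    exact ⟨s, t, hst, CanonicalTD.distinguishesEfficiently_endProfile hd⟩
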